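/- For integers $p,q\ge 3$, let $BS_2(\mathcal P_4:p,q)$ be the following two-player game. It starts in the plane (equivalently, on the sphere) with two spots, one having $p$ and the other $q$ open tips, i.e. free arms arranged cyclically around the spot. A move consists of joining two distinct open tips by a curve that does not cross anything already drawn, and then drawing a crossbar on this curve; the point where the crossbar meets the curve is a new vertex, and the crossbar creates two new open tips there, one on each side of the curve. The two joined tips are used up. At every stage, consider the plane graph whose vertices are the two spots and all crossbar points and whose edges are the pieces of curve between two such vertices. A move is valid only if after it this graph belongs to $\mathcal P_4$, the class of planar graphs of girth at least $4$, that is, it has no loops, no parallel edges and no triangles (a forest has infinite girth). The players alternate, and the first player who is unable to make a valid move loses. Then, for all integers $p,q\ge 3$, the second player has a winning strategy in $BS_2(\mathcal P_4:p,q)$. -/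

import Mathlib

/-!
# Two-spot generalized Brussels Sprouts for planar graphs of given girth

## Drawings

A drawing on the sphere (equivalently, in the plane), taken up to orientation-preserving
homeomorphism, is recorded by its rotation system.
A *dart* is an arm sitting at a vertex: either an open tip, or one end of an edge.
-/

/-- A drawing, given as a rotation system with open tips.  `rot` sends a dart to the next dart in
the cyclic order around the same vertex.  `mate` sends a dart that is one end of an edge to the
other end of that edge, and it fixes a dart that is an open tip. -/
structure SproutDrawing where
  Dart : Type
  [finiteDart : Finite Dart]
  [decEqDart : DecidableEq Dart]
  rot : Equiv.Perm Dart
  mate : Dart → Dart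
  mate_involutive : Function.Involutive mate

namespace SproutDrawing

attribute [instance] SproutDrawing.finiteDart SproutDrawing.decEqDart

/-- The dart `d` is an open tip. -/
def IsTip (D : SproutDrawing) (d : D.Dart) : Prop := D.mate d = d

/-- The permutation walking along the boundaries of the faces: cross to the other end of the
present arm, then turn to the next arm around the vertex reached. (At an open tip, one goes around
the tip and stays at the same vertex.) -/
def facePerm (D : SproutDrawing) : Equiv.Perm D.Dart :=
  (D.mate_involutive.toPerm D.mate).trans D.rot

/-- A vertex is a cycle of `rot`. -/
abbrev Vertex (D : SproutDrawing) : Type := Quotient (Equiv.Perm.SameCycle.setoid D.rot)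

/-- The vertex at which a dart sits. -/
def vertexOf (D : SproutDrawing) (d : D.Dart) : D.Vertex :=
  Quotient.mk (Equiv.Perm.SameCycle.setoid D.rot) d

/-- A face boundary is a cycle of `facePerm`. -/
abbrev Face (D : SproutDrawing) : Type := Quotient (Equiv.Perm.SameCycle.setoid D.facePerm)

/-- The edges, each given by the unordered pair of its two ends. -/
def edges (D : SproutDrawing) : Set (Sym2 D.Dart) :=
  {e | ∃ d, ¬ D.IsTip d ∧ e = s(d, D.mate d)}

/-- The adjacency relation between the vertices of the drawing. It ignores loops and multiplicities;
`IsSimple` below says that there are none. -/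
def graph (D : SproutDrawing) : SimpleGraph D.Vertex where
  Adj u v := u ≠ v ∧ ∃ d, ¬ D.IsTip d ∧ D.vertexOf d = u ∧ D.vertexOf (D.mate d) = v
  symm := ⟨by
    rintro u v ⟨huv, d, hd, rfl, rfl⟩
    refine ⟨huv.symm, D.mate d, ?_, rfl, ?_⟩
    · intro h
      apply hd
      have := D.mate_involutive d
      unfold IsTip at h ⊢
      rw [this] at h
      exact h.symm
    · rw [D.mate_involutive d]⟩
  loopless := ⟨fun _ h => h.1 rfl⟩

/-- There are no loops and no parallel edges. -/
def IsSimple (D : SproutDrawing) : Prop :=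
  (∀ d, ¬ D.IsTip d → D.vertexOf d ≠ D.vertexOf (D.mate d)) ∧
  ∀ d e, ¬ D.IsTip d → ¬ D.IsTip e → D.vertexOf d = D.vertexOf e →
    D.vertexOf (D.mate d) = D.vertexOf (D.mate e) → d = e

/-- The rotation system is planar, i.e. each connected component has genus zero:
Euler's formula `V - E + F = 2 C`, where `F` counts face boundaries and `C` components. -/
def IsPlanar (D : SproutDrawing) : Prop :=
  Nat.card D.Vertex + Nat.card D.Face = D.edges.ncard + 2 * Nat.card D.graph.ConnectedComponent

/-- The drawing is a plane drawing of a (simple) graph of girth at least `g`; a forest has infinite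
girth. -/
def IsPlanarOfGirth (g : ℕ) (D : SproutDrawing) : Prop :=
  D.IsPlanar ∧ D.IsSimple ∧ (g : ℕ∞) ≤ D.graph.egirth

/-- The new pairing of arm ends after the open tips `a` and `b` have been joined. The four arms of
the new vertex are, in cyclic order: `0`, the half of the curve leading to `a`; `1`, an open tip of
the crossbar; `2`, the half of the curve leading to `b`; `3`, the other open tip of the crossbar,
on the other side of the curve. -/
def joinMate (D : SproutDrawing) (a b : D.Dart) : D.Dart ⊕ Fin 4 → D.Dart ⊕ Fin 4
  | Sum.inl d => if d = a then Sum.inr 0 else if d = b then Sum.inr 2 else Sum.inl (D.mate d)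
  | Sum.inr 0 => Sum.inl a
  | Sum.inr 1 => Sum.inr 1
  | Sum.inr 2 => Sum.inl b
  | Sum.inr 3 => Sum.inr 3

theorem joinMate_involutive (D : SproutDrawing) {a b : D.Dart} (hab : a ≠ b)
    (ha : D.IsTip a) (hb : D.IsTip b) : Function.Involutive (D.joinMate a b) := by
  unfold IsTip at ha hb
  have hinj := D.mate_involutive.injective
  rintro (d | i)
  · by_cases h1 : d = a
    · simp [joinMate, h1]
    · by_cases h2 : d = b
      · simp [joinMate, h2, hab.symm]
      · have h3 : D.mate d ≠ a := fun h => h1 (hinj (h.trans ha.symm))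
        have h4 : D.mate d ≠ b := fun h => h2 (hinj (h.trans hb.symm))
        simp [joinMate, h1, h2, h3, h4, D.mate_involutive d]
  · fin_cases i <;> simp [joinMate, hab.symm]

/-- Join the distinct open tips `a` and `b` by a curve and draw a crossbar on it. -/
def join (D : SproutDrawing) (a b : D.Dart) (hab : a ≠ b) (ha : D.IsTip a) (hb : D.IsTip b) :
    SproutDrawing where
  Dart := D.Dart ⊕ Fin 4
  rot := Equiv.sumCongr D.rot (finRotate 4)
  mate := D.joinMate a b
  mate_involutive := D.joinMate_involutive hab ha hb

/-- A valid move: join two open tips by a curve and draw a crossbar on it, so that the result is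
again drawn without crossings and its graph is planar of girth at least `g`. (When two tips are on
the same connected component, the curve can be drawn without crossings, i.e. inside one face, exactly
if the new rotation system is planar.) -/
def Move (g : ℕ) (D D' : SproutDrawing) : Prop :=
  ∃ (a b : D.Dart) (hab : a ≠ b) (ha : D.IsTip a) (hb : D.IsTip b),
    D' = D.join a b hab ha hb ∧ D'.IsPlanarOfGirth g

/-- The starting position: two spots, with `p` and `q` open tips, and no edges.

For two spots and `3 ≤ g`, this is the only disconnected position: the two tips of the first move
cannot be at the same spot, since that would create parallel edges. In this position both spots are
in the one and only region, and all other positions are determined up to homeomorphism of the sphere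
by their rotation systems. -/
def twoSpots (p q : ℕ) : SproutDrawing where
  Dart := Fin p ⊕ Fin q
  rot := Equiv.sumCongr (finRotate p) (finRotate q)
  mate := id
  mate_involutive := fun _ => rfl

end SproutDrawing

/-!
## Winning strategies in normal play
-/

/-- The positions, with the first player to move, that may be reached from `start` when the second
player answers each position `Q` left by the first player by moving to `s Q`. -/
inductive ReachedAgainst {α : Type*} (Move : α → α → Prop) (s : α → α) (start : α) : α → Prop
  | start : ReachedAgainst Move s start start
  | round {P Q : α} : ReachedAgainst Move s start P → Move P Q →
      ReachedAgainst Move s start (s Q)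

/-- The second player has a winning strategy in the game from `start`, where the players alternate
and a player who cannot move loses: there is a strategy that gives a valid answer to every move of
the first player, and against which the first player cannot go on moving forever. -/
def SecondPlayerHasWinningStrategy {α : Type*} (Move : α → α → Prop) (start : α) : Prop :=
  ∃ s : α → α,
    (∀ P Q, ReachedAgainst Move s start P → Move P Q → Move Q (s Q)) ∧
    ¬ ∃ f : ℕ → α, f 0 = start ∧ ∀ n, ∃ Q, Move (f n) Q ∧ f (n + 1) = s Q

/-! A move inside a connected drawing is valid exactly when its two tips lie in one face, at
distinct non-adjacent vertices: adjacency would create a triangle with the crossbar point, and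
Euler's formula excludes tips in different faces (`IsAdmissible.join`, `IsAdmissible.joinable`).

The first move must join the two spots `A` and `B` through a crossbar point `n`. The second player
joins the next tips around `A` and `B` through a point `N`, which gives a 4-cycle `A n B N`. The
tips left at `A` fall into one of its two faces and those left at `B` into the other; each face also
has one tip at `n` and one at `N`. Since each spot had at least three tips, neither kind is empty.
Each spot is adjacent to both `n` and `N`, so the only move in a face joins `n` to `N`. This is the
situation called `Forced` (`forced_of_joinable_opening`).

When that move is made in the face with the tips of `B`, the curve cuts off one side where its new
point `x` has the only tip. On the other side `x` has a tip next to those of `B`, and `x` is not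
adjacent to `B`. The second player joins `x` to a tip of `B`; all tips then left on that side are at
`B` or at the newest point, which is adjacent to `B`, so the face is exhausted
(`Forced.exists_reply`, `oldFace_ne_of_joinable_join`). Other faces are untouched (`Forced.join`).
Hence the second player always has an answer that keeps every available move forced, and the number
of joinable pairs drops in each round (`AllForced.exists_reply`). -/

/-! ### Winning strategies from an invariant and a decreasing measure -/

theorem SecondPlayerHasWinningStrategy.of_invariant {α : Type*} {Move : α → α → Prop} {start : α}
    (P : α → Prop) (μ : α → ℕ)
    (hstart : ∀ Q, Move start Q → ∃ R, Move Q R ∧ P R)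
    (hP : ∀ D Q, P D → Move D Q → ∃ R, Move Q R ∧ P R ∧ μ R < μ D) :
    SecondPlayerHasWinningStrategy Move start := by
  classical
  -- A strategy sees only `Q`, not the position `D` it came from. A reply of least measure lies
  -- below every possible predecessor `D` at once.
  have key : ∀ Q, (∃ R, Move Q R ∧ P R) →
      ∃ R, (Move Q R ∧ P R) ∧ ∀ R', Move Q R' → P R' → μ R ≤ μ R' := by
    intro Q hQ
    have h : ∃ n R, (Move Q R ∧ P R) ∧ μ R = n := by
      obtain ⟨R, hR⟩ := hQ
      exact ⟨_, R, hR, rfl⟩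
    obtain ⟨R, hR, hn⟩ := Nat.find_spec h
    exact ⟨R, hR, fun R' h1 h2 => hn ▸ Nat.find_min' h ⟨R', ⟨h1, h2⟩, rfl⟩⟩
  let s : α → α := fun Q => if h : ∃ R, Move Q R ∧ P R then (key Q h).choose else Q
  have hs : ∀ Q, (∃ R, Move Q R ∧ P R) →
      (Move Q (s Q) ∧ P (s Q)) ∧ ∀ R', Move Q R' → P R' → μ (s Q) ≤ μ R' := by
    intro Q hQ
    simp only [s, dif_pos hQ]
    exact (key Q hQ).choose_spec
  have hreply : ∀ D Q, D = start ∨ P D → Move D Q → ∃ R, Move Q R ∧ P R := by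
    rintro D Q (rfl | hD) hm
    · exact hstart Q hm
    · obtain ⟨R, h1, h2, -⟩ := hP D Q hD hm
      exact ⟨R, h1, h2⟩
  have hreach : ∀ D, ReachedAgainst Move s start D → D = start ∨ P D := by
    intro D hD
    induction hD with
    | start => exact Or.inl rfl
    | round _ hm ih => exact Or.inr (hs _ (hreply _ _ ih hm)).1.2
  refine ⟨s, fun D Q hD hm => (hs Q (hreply D Q (hreach D hD) hm)).1.1, ?_⟩
  rintro ⟨f, hf0, hf⟩
  have hfP : ∀ n, P (f (n + 1)) := by
    intro n
    induction n with
    | zero =>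
      obtain ⟨Q, hm, h1⟩ := hf 0
      rw [h1]
      exact (hs Q (hreply _ _ (Or.inl hf0) hm)).1.2
    | succ n ih =>
      obtain ⟨Q, hm, h1⟩ := hf (n + 1)
      rw [h1]
      exact (hs Q (hreply _ _ (Or.inr ih) hm)).1.2
  -- The descent is counted from `f 1`, because `P` and the bound on `μ` are not available at
  -- `start`.
  have hdec : ∀ n, μ (f (n + 1)) + n ≤ μ (f 1) := by
    intro n
    induction n with
    | zero => simp
    | succ n ih =>
      obtain ⟨Q, hm, h1⟩ := hf (n + 1)
      obtain ⟨R, hR, hPR, hlt⟩ := hP _ Q (hfP n) hm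
      have := (hs Q ⟨R, hR, hPR⟩).2 R hR hPR
      rw [← h1] at this
      omega
  have := hdec (μ (f 1) + 1)
  omega

/-! ### Cycles of permutations, and girth at least four -/

/-- On a finite type nonnegative powers already exhaust a cycle, so forward closure suffices. Face
boundaries are controlled below by exhibiting such closed sets. -/
theorem Equiv.Perm.SameCycle.mem_of_mapsTo {α : Type*} [Finite α] {f : Equiv.Perm α} {S : Set α}
    (hS : ∀ x ∈ S, f x ∈ S) {x y : α} (h : f.SameCycle x y) (hx : x ∈ S) : y ∈ S := by
  obtain ⟨n, rfl⟩ := h.exists_nat_pow_eq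
  induction n with
  | zero => simpa
  | succ n ih =>
    rw [pow_succ', Equiv.Perm.mul_apply]
    exact hS _ (ih ⟨n, by simp⟩)

/-- The exponent is at least one, so for `x = y` this is the first return and describes a full turn
around the cycle. -/
theorem Equiv.Perm.SameCycle.exists_first_iterate {α : Type*} [Finite α] {f : Equiv.Perm α}
    {x y : α} (h : f.SameCycle x y) :
    ∃ n, f^[n + 1] x = y ∧ ∀ i < n, f^[i + 1] x ≠ y := by
  classical
  have hex : ∃ n, f^[n + 1] x = y := by
    obtain ⟨i, hi, -, hxy⟩ := h.exists_pow_eq''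
    refine ⟨i - 1, ?_⟩
    rw [Nat.sub_add_cancel hi, Equiv.Perm.iterate_eq_pow]
    exact hxy
  exact ⟨Nat.find hex, Nat.find_spec hex, fun i hi => Nat.find_min hex hi⟩

theorem Equiv.Perm.sameCycle_iterate_right {α : Type*} (f : Equiv.Perm α) (x : α) (n : ℕ) :
    f.SameCycle x (f^[n] x) := by
  rw [Equiv.Perm.iterate_eq_pow]
  exact ⟨n, by simp⟩

theorem Equiv.Perm.sumCongr_zpow {α β : Type*} (e : Equiv.Perm α) (f : Equiv.Perm β) (n : ℤ) :
    Equiv.sumCongr e f ^ n = Equiv.sumCongr (e ^ n) (f ^ n) :=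
  (map_zpow (Equiv.Perm.sumCongrHom α β) (e, f) n).symm

theorem Equiv.Perm.sameCycle_sumCongr_inl {α β : Type*} {e : Equiv.Perm α} {f : Equiv.Perm β}
    {x y : α} : Equiv.Perm.SameCycle (Equiv.sumCongr e f) (Sum.inl x) (Sum.inl y) ↔
      e.SameCycle x y := by
  simp [Equiv.Perm.SameCycle, Equiv.Perm.sumCongr_zpow]

theorem Equiv.Perm.sameCycle_sumCongr_inr {α β : Type*} {e : Equiv.Perm α} {f : Equiv.Perm β}
    {x y : β} : Equiv.Perm.SameCycle (Equiv.sumCongr e f) (Sum.inr x) (Sum.inr y) ↔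
      f.SameCycle x y := by
  simp [Equiv.Perm.SameCycle, Equiv.Perm.sumCongr_zpow]

theorem Equiv.Perm.not_sameCycle_sumCongr {α β : Type*} {e : Equiv.Perm α} {f : Equiv.Perm β}
    {x : α} {y : β} : ¬ Equiv.Perm.SameCycle (Equiv.sumCongr e f) (Sum.inl x) (Sum.inr y) := by
  simp [Equiv.Perm.SameCycle, Equiv.Perm.sumCongr_zpow]

theorem sameCycle_finRotate {n : ℕ} (x y : Fin n) : (finRotate n).SameCycle x y := by
  rcases n with _ | _ | n
  · exact x.elim0
  · obtain rfl : x = y := Fin.ext (by omega)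
    exact .refl _ _
  · have h := isCycle_finRotate (n := n)
    refine h.sameCycle ?_ ?_ <;>
    · rw [← Equiv.Perm.mem_support, support_finRotate]
      exact Finset.mem_univ _

/-- Every cycle has length at least three, so only triangles have to be excluded. -/
theorem SimpleGraph.four_le_egirth_iff {V : Type*} {G : SimpleGraph V} :
    (4 : ℕ∞) ≤ G.egirth ↔ ∀ u v w, G.Adj u v → G.Adj v w → ¬ G.Adj u w := by
  classical
  constructor
  · intro h u v w h1 h2 h3
    obtain ⟨x, p, hp, hl⟩ := SimpleGraph.is3Clique_iff_exists_cycle_length_three.1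
      ⟨{u, v, w}, SimpleGraph.is3Clique_triple_iff.2 ⟨h1, h3, h2⟩⟩
    have := SimpleGraph.le_egirth.1 h x p hp
    rw [hl] at this
    exact absurd this (by decide)
  · intro h
    rw [SimpleGraph.le_egirth]
    intro x p hp
    have h3 := hp.three_le_length
    have hne : p.length ≠ 3 := by
      intro hl
      obtain ⟨s, hs⟩ := SimpleGraph.is3Clique_iff_exists_cycle_length_three.2 ⟨x, p, hp, hl⟩
      obtain ⟨u, v, w, h1, h2, h3, -⟩ := SimpleGraph.is3Clique_iff.1 hs
      exact h u v w h1 h3 h2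
    exact_mod_cast (show 4 ≤ p.length by omega)

/-! ### Vertices and faces of a drawing, and how a move changes them -/

namespace SproutDrawing

theorem vertexOf_eq_iff {D : SproutDrawing} {d e : D.Dart} :
    D.vertexOf d = D.vertexOf e ↔ D.rot.SameCycle d e :=
  Quotient.eq (r := Equiv.Perm.SameCycle.setoid D.rot)

theorem vertexOf_rot (D : SproutDrawing) (d : D.Dart) : D.vertexOf (D.rot d) = D.vertexOf d :=
  vertexOf_eq_iff.2 (Equiv.Perm.sameCycle_apply_left.2 (.refl _ _))

theorem vertexOf_surjective (D : SproutDrawing) : Function.Surjective D.vertexOf :=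
  Quotient.mk_surjective

/-- The face boundary along which a dart lies. -/
def faceOf (D : SproutDrawing) (d : D.Dart) : D.Face :=
  Quotient.mk (Equiv.Perm.SameCycle.setoid D.facePerm) d

theorem faceOf_eq_iff {D : SproutDrawing} {d e : D.Dart} :
    D.faceOf d = D.faceOf e ↔ D.facePerm.SameCycle d e :=
  Quotient.eq (r := Equiv.Perm.SameCycle.setoid D.facePerm)

theorem faceOf_facePerm (D : SproutDrawing) (d : D.Dart) :
    D.faceOf (D.facePerm d) = D.faceOf d :=
  faceOf_eq_iff.2 (Equiv.Perm.sameCycle_apply_left.2 (.refl _ _))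

theorem faceOf_iterate (D : SproutDrawing) (d : D.Dart) (n : ℕ) :
    D.faceOf (D.facePerm^[n] d) = D.faceOf d :=
  faceOf_eq_iff.2 (Equiv.Perm.sameCycle_iterate_right _ _ _).symm

theorem faceOf_surjective (D : SproutDrawing) : Function.Surjective D.faceOf :=
  Quotient.mk_surjective

theorem adj_iff {D : SproutDrawing} {u v : D.Vertex} : D.graph.Adj u v ↔
    u ≠ v ∧ ∃ d, ¬ D.IsTip d ∧ D.vertexOf d = u ∧ D.vertexOf (D.mate d) = v :=
  Iff.rfl

section Join

variable {D : SproutDrawing} {a b : D.Dart} (hab : a ≠ b) (ha : D.IsTip a) (hb : D.IsTip b)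

/-- A dart of `D`, as a dart of the drawing after a move. -/
def old (d : D.Dart) : (D.join a b hab ha hb).Dart := Sum.inl d

/-- A dart at the crossbar point of a move. -/
def new (i : Fin 4) : (D.join a b hab ha hb).Dart := Sum.inr i

theorem join_cases (x : (D.join a b hab ha hb).Dart) :
    (∃ d, x = old hab ha hb d) ∨ ∃ i, x = new hab ha hb i := by
  rcases x with d | i
  · exact Or.inl ⟨d, rfl⟩
  · exact Or.inr ⟨i, rfl⟩

@[simp] theorem old_inj {d e : D.Dart} : old hab ha hb d = old hab ha hb e ↔ d = e :=
  Sum.inl_injective.eq_iff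

@[simp] theorem new_inj {i j : Fin 4} : new hab ha hb i = new hab ha hb j ↔ i = j :=
  Sum.inr_injective.eq_iff

@[simp] theorem old_ne_new {d : D.Dart} {i : Fin 4} : old hab ha hb d ≠ new hab ha hb i :=
  Sum.inl_ne_inr

@[simp] theorem new_ne_old {d : D.Dart} {i : Fin 4} : new hab ha hb i ≠ old hab ha hb d :=
  Sum.inr_ne_inl

@[simp] theorem rot_old (d : D.Dart) :
    (D.join a b hab ha hb).rot (old hab ha hb d) = old hab ha hb (D.rot d) := rfl

@[simp] theorem rot_new (i : Fin 4) :
    (D.join a b hab ha hb).rot (new hab ha hb i) = new hab ha hb (i + 1) := by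
  rw [← finRotate_apply]
  rfl

theorem mate_old {d : D.Dart} (h1 : d ≠ a) (h2 : d ≠ b) :
    (D.join a b hab ha hb).mate (old hab ha hb d) = old hab ha hb (D.mate d) := by
  simp [join, joinMate, old, h1, h2]

@[simp] theorem mate_left :
    (D.join a b hab ha hb).mate (old hab ha hb a) = new hab ha hb 0 := by
  simp [join, joinMate, old, new]

@[simp] theorem mate_right :
    (D.join a b hab ha hb).mate (old hab ha hb b) = new hab ha hb 2 := by
  simp [join, joinMate, old, new, hab.symm]

@[simp] theorem mate_new_zero :
    (D.join a b hab ha hb).mate (new hab ha hb 0) = old hab ha hb a := rfl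

@[simp] theorem mate_new_one :
    (D.join a b hab ha hb).mate (new hab ha hb 1) = new hab ha hb 1 := rfl

@[simp] theorem mate_new_two :
    (D.join a b hab ha hb).mate (new hab ha hb 2) = old hab ha hb b := rfl

@[simp] theorem mate_new_three :
    (D.join a b hab ha hb).mate (new hab ha hb 3) = new hab ha hb 3 := rfl

theorem facePerm_apply (E : SproutDrawing) (d : E.Dart) : E.facePerm d = E.rot (E.mate d) := rfl

theorem facePerm_old {d : D.Dart} (h1 : d ≠ a) (h2 : d ≠ b) :
    (D.join a b hab ha hb).facePerm (old hab ha hb d) = old hab ha hb (D.facePerm d) := by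
  rw [facePerm_apply, mate_old _ _ _ h1 h2, rot_old, facePerm_apply]

theorem facePerm_left :
    (D.join a b hab ha hb).facePerm (old hab ha hb a) = new hab ha hb 1 := by
  simp [facePerm_apply]

theorem facePerm_right :
    (D.join a b hab ha hb).facePerm (old hab ha hb b) = new hab ha hb 3 := by
  simp [facePerm_apply]

theorem facePerm_new_zero :
    (D.join a b hab ha hb).facePerm (new hab ha hb 0) = old hab ha hb (D.facePerm a) := by
  have : D.mate a = a := ha
  simp [facePerm_apply, this]

theorem facePerm_new_one :
    (D.join a b hab ha hb).facePerm (new hab ha hb 1) = new hab ha hb 2 := by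
  simp [facePerm_apply]

theorem facePerm_new_two :
    (D.join a b hab ha hb).facePerm (new hab ha hb 2) = old hab ha hb (D.facePerm b) := by
  have : D.mate b = b := hb
  simp [facePerm_apply, this]

theorem facePerm_new_three :
    (D.join a b hab ha hb).facePerm (new hab ha hb 3) = new hab ha hb 0 := by
  simp [facePerm_apply]

theorem isTip_old {d : D.Dart} :
    (D.join a b hab ha hb).IsTip (old hab ha hb d) ↔ D.IsTip d ∧ d ≠ a ∧ d ≠ b := by
  by_cases h1 : d = a
  · simp [IsTip, h1]
  · by_cases h2 : d = b
    · simp [IsTip, h2]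
    · simp [IsTip, mate_old, h1, h2]

theorem isTip_new {i : Fin 4} :
    (D.join a b hab ha hb).IsTip (new hab ha hb i) ↔ i = 1 ∨ i = 3 := by
  fin_cases i <;> simp [IsTip]

theorem vertexOf_old_eq_old {d e : D.Dart} :
    (D.join a b hab ha hb).vertexOf (old hab ha hb d) =
      (D.join a b hab ha hb).vertexOf (old hab ha hb e) ↔ D.vertexOf d = D.vertexOf e := by
  rw [vertexOf_eq_iff, vertexOf_eq_iff]
  exact Equiv.Perm.sameCycle_sumCongr_inl

theorem vertexOf_new_eq_new (i j : Fin 4) :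
    (D.join a b hab ha hb).vertexOf (new hab ha hb i) =
      (D.join a b hab ha hb).vertexOf (new hab ha hb j) := by
  rw [vertexOf_eq_iff]
  exact Equiv.Perm.sameCycle_sumCongr_inr.2 (sameCycle_finRotate i j)

theorem vertexOf_old_ne_new {d : D.Dart} {i : Fin 4} :
    (D.join a b hab ha hb).vertexOf (old hab ha hb d) ≠
      (D.join a b hab ha hb).vertexOf (new hab ha hb i) := by
  rw [Ne, vertexOf_eq_iff]
  exact Equiv.Perm.not_sameCycle_sumCongr

theorem adj_old_old {d e : D.Dart} :
    (D.join a b hab ha hb).graph.Adj ((D.join a b hab ha hb).vertexOf (old hab ha hb d))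
      ((D.join a b hab ha hb).vertexOf (old hab ha hb e)) ↔
      D.graph.Adj (D.vertexOf d) (D.vertexOf e) := by
  rw [adj_iff, adj_iff, Ne, vertexOf_old_eq_old]
  refine and_congr_right fun _ => ⟨?_, ?_⟩
  · rintro ⟨x, hx, hd, he⟩
    rcases join_cases hab ha hb x with ⟨f, rfl⟩ | ⟨i, rfl⟩
    · by_cases h1 : f = a
      · subst h1
        rw [mate_left] at he
        exact absurd he.symm (vertexOf_old_ne_new _ _ _)
      by_cases h2 : f = b
      · subst h2
        rw [mate_right] at he
        exact absurd he.symm (vertexOf_old_ne_new _ _ _)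
      rw [mate_old _ _ _ h1 h2, vertexOf_old_eq_old] at he
      rw [vertexOf_old_eq_old] at hd
      exact ⟨f, fun h => hx ((isTip_old _ _ _).2 ⟨h, h1, h2⟩), hd, he⟩
    · exact absurd hd.symm (vertexOf_old_ne_new _ _ _)
  · rintro ⟨f, hf, hd, he⟩
    have h1 : f ≠ a := fun h => hf (h ▸ ha)
    have h2 : f ≠ b := fun h => hf (h ▸ hb)
    refine ⟨old hab ha hb f, fun h => hf ((isTip_old _ _ _).1 h).1, ?_, ?_⟩
    · rw [vertexOf_old_eq_old, hd]
    · rw [mate_old _ _ _ h1 h2, vertexOf_old_eq_old, he]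

theorem adj_new_old {i : Fin 4} {d : D.Dart} :
    (D.join a b hab ha hb).graph.Adj ((D.join a b hab ha hb).vertexOf (new hab ha hb i))
      ((D.join a b hab ha hb).vertexOf (old hab ha hb d)) ↔
      D.vertexOf d = D.vertexOf a ∨ D.vertexOf d = D.vertexOf b := by
  rw [adj_iff]
  constructor
  · rintro ⟨-, x, hx, hi, hd⟩
    rcases join_cases hab ha hb x with ⟨f, rfl⟩ | ⟨j, rfl⟩
    · exact absurd hi (vertexOf_old_ne_new _ _ _)
    · rw [isTip_new] at hx
      fin_cases j
      · exact Or.inl ((vertexOf_old_eq_old hab ha hb).1 hd.symm)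
      · simp at hx
      · exact Or.inr ((vertexOf_old_eq_old hab ha hb).1 hd.symm)
      · simp at hx
  · intro h
    refine ⟨(vertexOf_old_ne_new _ _ _).symm, ?_⟩
    rcases h with h | h
    · refine ⟨new hab ha hb 0, by simp [isTip_new], vertexOf_new_eq_new _ _ _ _ _, ?_⟩
      rw [mate_new_zero, vertexOf_old_eq_old, h]
    · refine ⟨new hab ha hb 2, by simp [isTip_new], vertexOf_new_eq_new _ _ _ _ _, ?_⟩
      rw [mate_new_two, vertexOf_old_eq_old, h]

theorem adj_old_new {i : Fin 4} {d : D.Dart} :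
    (D.join a b hab ha hb).graph.Adj ((D.join a b hab ha hb).vertexOf (old hab ha hb d))
      ((D.join a b hab ha hb).vertexOf (new hab ha hb i)) ↔
      D.vertexOf d = D.vertexOf a ∨ D.vertexOf d = D.vertexOf b := by
  rw [SimpleGraph.adj_comm, adj_new_old]

/-! ### Faces after a move -/

theorem faceOf_new_two : (D.join a b hab ha hb).faceOf (new hab ha hb 2) =
    (D.join a b hab ha hb).faceOf (new hab ha hb 1) := by
  rw [← facePerm_new_one, faceOf_facePerm]

theorem faceOf_old_left : (D.join a b hab ha hb).faceOf (old hab ha hb a) =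
    (D.join a b hab ha hb).faceOf (new hab ha hb 1) := by
  rw [← facePerm_left, faceOf_facePerm]

theorem faceOf_new_zero : (D.join a b hab ha hb).faceOf (new hab ha hb 0) =
    (D.join a b hab ha hb).faceOf (new hab ha hb 3) := by
  rw [← facePerm_new_three, faceOf_facePerm]

theorem faceOf_old_right : (D.join a b hab ha hb).faceOf (old hab ha hb b) =
    (D.join a b hab ha hb).faceOf (new hab ha hb 3) := by
  rw [← facePerm_right, faceOf_facePerm]

theorem faceOf_old_facePerm_left :
    (D.join a b hab ha hb).faceOf (old hab ha hb (D.facePerm a)) =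
      (D.join a b hab ha hb).faceOf (new hab ha hb 3) := by
  rw [← facePerm_new_zero, faceOf_facePerm, faceOf_new_zero]

theorem faceOf_old_facePerm_right :
    (D.join a b hab ha hb).faceOf (old hab ha hb (D.facePerm b)) =
      (D.join a b hab ha hb).faceOf (new hab ha hb 1) := by
  rw [← facePerm_new_two, faceOf_facePerm, faceOf_new_two]

/-- Where a dart of the new drawing lies in the old one. -/
def oldFace : (D.join a b hab ha hb).Dart → D.Face
  | Sum.inl d => D.faceOf d
  | Sum.inr _ => D.faceOf a

theorem oldFace_old (d : D.Dart) : oldFace hab ha hb (old hab ha hb d) = D.faceOf d := rfl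

theorem oldFace_new (i : Fin 4) : oldFace hab ha hb (new hab ha hb i) = D.faceOf a := rfl

theorem oldFace_eq_of_faceOf_eq (hf : D.faceOf a = D.faceOf b)
    {x y : (D.join a b hab ha hb).Dart}
    (h : (D.join a b hab ha hb).faceOf x = (D.join a b hab ha hb).faceOf y) :
    oldFace hab ha hb x = oldFace hab ha hb y := by
  refine (Equiv.Perm.SameCycle.mem_of_mapsTo
    (S := {z | oldFace hab ha hb z = oldFace hab ha hb x}) ?_ (faceOf_eq_iff.1 h) rfl).symm
  intro z hz
  refine Eq.trans ?_ hz
  rcases join_cases hab ha hb z with ⟨d, rfl⟩ | ⟨i, rfl⟩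
  · by_cases h1 : d = a
    · subst h1
      rw [facePerm_left, oldFace_new, oldFace_old]
    by_cases h2 : d = b
    · subst h2
      rw [facePerm_right, oldFace_new, oldFace_old, hf]
    rw [facePerm_old _ _ _ h1 h2, oldFace_old, oldFace_old, faceOf_facePerm]
  · obtain rfl | rfl | rfl | rfl : i = 0 ∨ i = 1 ∨ i = 2 ∨ i = 3 := by fin_cases i <;> simp
    · rw [facePerm_new_zero, oldFace_old, oldFace_new, faceOf_facePerm]
    · rw [facePerm_new_one, oldFace_new, oldFace_new]
    · rw [facePerm_new_two, oldFace_old, oldFace_new, faceOf_facePerm, hf]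
    · rw [facePerm_new_three, oldFace_new, oldFace_new]

end Join

/-! ### The two sides of the new curve, and the counts in Euler's formula -/

section Join

variable {D : SproutDrawing} {a b : D.Dart} (hab : a ≠ b) (ha : D.IsTip a) (hb : D.IsTip b)

theorem mem_of_faceOf_eq {D : SproutDrawing} {S : Set D.Dart} (hS : ∀ x ∈ S, D.facePerm x ∈ S)
    {x y : D.Dart} (h : D.faceOf x = D.faceOf y) (hx : x ∈ S) : y ∈ S :=
  (faceOf_eq_iff.1 h).mem_of_mapsTo hS hx

/-- The region to the left of the new curve consists of the arc from `a` to `b`. -/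
theorem mem_of_faceOf_eq_new_three {n : ℕ} (hn : D.facePerm^[n + 1] a = b)
    (hlt : ∀ i < n, D.facePerm^[i + 1] a ≠ a ∧ D.facePerm^[i + 1] a ≠ b)
    {y : (D.join a b hab ha hb).Dart}
    (h : (D.join a b hab ha hb).faceOf y = (D.join a b hab ha hb).faceOf (new hab ha hb 3)) :
    y = new hab ha hb 3 ∨ y = new hab ha hb 0 ∨ y = old hab ha hb b ∨
      ∃ i < n, y = old hab ha hb (D.facePerm^[i + 1] a) := by
  have key : ∀ i ≤ n, old hab ha hb (D.facePerm^[i + 1] a) = old hab ha hb b ∨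
      ∃ j < n, old hab ha hb (D.facePerm^[i + 1] a) =
        old hab ha hb (D.facePerm^[j + 1] a) := by
    intro i hi
    rcases hi.eq_or_lt with rfl | hi
    · rw [hn]
      exact Or.inl rfl
    · exact Or.inr ⟨i, hi, rfl⟩
  refine mem_of_faceOf_eq (S := {y | y = new hab ha hb 3 ∨ y = new hab ha hb 0 ∨
    y = old hab ha hb b ∨ ∃ i < n, y = old hab ha hb (D.facePerm^[i + 1] a)}) ?_ h.symm (Or.inl rfl)
  rintro x (rfl | rfl | rfl | ⟨i, hi, rfl⟩)
  · exact Or.inr (Or.inl (facePerm_new_three hab ha hb))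
  · refine Or.inr (Or.inr ?_)
    rw [facePerm_new_zero]
    exact key 0 (Nat.zero_le _)
  · exact Or.inl (facePerm_right hab ha hb)
  · refine Or.inr (Or.inr ?_)
    rw [facePerm_old _ _ _ (hlt i hi).1 (hlt i hi).2, ← Function.iterate_succ_apply' D.facePerm]
    exact key (i + 1) hi

/-- The region to the right of the new curve consists of the arc from `b` to `a`. -/
theorem mem_of_faceOf_eq_new_one {n : ℕ} (hn : D.facePerm^[n + 1] b = a)
    (hlt : ∀ i < n, D.facePerm^[i + 1] b ≠ a ∧ D.facePerm^[i + 1] b ≠ b)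
    {y : (D.join a b hab ha hb).Dart}
    (h : (D.join a b hab ha hb).faceOf y = (D.join a b hab ha hb).faceOf (new hab ha hb 1)) :
    y = new hab ha hb 1 ∨ y = new hab ha hb 2 ∨ y = old hab ha hb a ∨
      ∃ i < n, y = old hab ha hb (D.facePerm^[i + 1] b) := by
  have key : ∀ i ≤ n, old hab ha hb (D.facePerm^[i + 1] b) = old hab ha hb a ∨
      ∃ j < n, old hab ha hb (D.facePerm^[i + 1] b) =
        old hab ha hb (D.facePerm^[j + 1] b) := by
    intro i hi
    rcases hi.eq_or_lt with rfl | hi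
    · rw [hn]
      exact Or.inl rfl
    · exact Or.inr ⟨i, hi, rfl⟩
  refine mem_of_faceOf_eq (S := {y | y = new hab ha hb 1 ∨ y = new hab ha hb 2 ∨
    y = old hab ha hb a ∨ ∃ i < n, y = old hab ha hb (D.facePerm^[i + 1] b)}) ?_ h.symm (Or.inl rfl)
  rintro x (rfl | rfl | rfl | ⟨i, hi, rfl⟩)
  · exact Or.inr (Or.inl (facePerm_new_one hab ha hb))
  · refine Or.inr (Or.inr ?_)
    rw [facePerm_new_two]
    exact key 0 (Nat.zero_le _)
  · exact Or.inl (facePerm_left hab ha hb)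
  · refine Or.inr (Or.inr ?_)
    rw [facePerm_old _ _ _ (hlt i hi).1 (hlt i hi).2, ← Function.iterate_succ_apply' D.facePerm]
    exact key (i + 1) hi

theorem faceOf_new_one_ne_new_three (hf : D.faceOf a = D.faceOf b) :
    (D.join a b hab ha hb).faceOf (new hab ha hb 1) ≠
      (D.join a b hab ha hb).faceOf (new hab ha hb 3) := by
  intro h
  obtain ⟨n, hn, hlt⟩ := (faceOf_eq_iff.1 hf).exists_first_iterate
  -- A return to `a` after `i + 1` steps would leave only `n - i` steps from `a` to `b`, fewer than
  -- the first passage needs.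
  have hlt' : ∀ i < n, D.facePerm^[i + 1] a ≠ a ∧ D.facePerm^[i + 1] a ≠ b := by
    refine fun i hi => ⟨fun h => ?_, hlt i hi⟩
    obtain ⟨k, rfl⟩ := Nat.exists_eq_add_of_lt hi
    refine hlt k (by omega) ?_
    rw [← hn, show i + k + 1 + 1 = (k + 1) + (i + 1) by omega, Function.iterate_add_apply _ (k + 1), h]
  have := mem_of_faceOf_eq_new_three hab ha hb hn hlt' h
  simp at this

/-- The face walk changes only at `a` and `b`, which this face does not contain. -/
theorem faceOf_old_eq_of_faceOf_ne {d e : D.Dart} (hda : D.faceOf d ≠ D.faceOf a)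
    (hdb : D.faceOf d ≠ D.faceOf b) (h : D.faceOf d = D.faceOf e) :
    (D.join a b hab ha hb).faceOf (old hab ha hb d) =
      (D.join a b hab ha hb).faceOf (old hab ha hb e) := by
  refine (mem_of_faceOf_eq (S := {z | D.faceOf z = D.faceOf d ∧
    (D.join a b hab ha hb).faceOf (old hab ha hb d) =
      (D.join a b hab ha hb).faceOf (old hab ha hb z)}) ?_ h ⟨rfl, rfl⟩).2
  rintro z ⟨hz, hz'⟩
  refine ⟨(faceOf_facePerm _ _).trans hz, hz'.trans ?_⟩
  rw [← facePerm_old, faceOf_facePerm]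
  · rintro rfl
    exact hda hz.symm
  · rintro rfl
    exact hdb hz.symm

/-- Along the old boundary, passing `a` or `b` switches from one side of the curve to the other, and
every other step stays on its side. -/
theorem faceOf_old_of_faceOf_eq (hf : D.faceOf a = D.faceOf b) {d : D.Dart}
    (hd : D.faceOf d = D.faceOf a) :
    (D.join a b hab ha hb).faceOf (old hab ha hb d) =
        (D.join a b hab ha hb).faceOf (new hab ha hb 1) ∨
      (D.join a b hab ha hb).faceOf (old hab ha hb d) =
        (D.join a b hab ha hb).faceOf (new hab ha hb 3) := by
  refine mem_of_faceOf_eq (S := {z | (D.join a b hab ha hb).faceOf (old hab ha hb z) =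
        (D.join a b hab ha hb).faceOf (new hab ha hb 1) ∨
      (D.join a b hab ha hb).faceOf (old hab ha hb z) =
        (D.join a b hab ha hb).faceOf (new hab ha hb 3)}) ?_ hd.symm
    (Or.inl (faceOf_old_left hab ha hb))
  intro z hz
  by_cases h1 : z = a
  · subst h1
    exact Or.inr (faceOf_old_facePerm_left hab ha hb)
  by_cases h2 : z = b
  · subst h2
    exact Or.inl (faceOf_old_facePerm_right hab ha hb)
  rw [Set.mem_ofPred_eq, ← facePerm_old hab ha hb h1 h2, faceOf_facePerm]
  exact hz

theorem faceOf_new_eq (i : Fin 4) :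
    (D.join a b hab ha hb).faceOf (new hab ha hb i) =
        (D.join a b hab ha hb).faceOf (new hab ha hb 1) ∨
      (D.join a b hab ha hb).faceOf (new hab ha hb i) =
        (D.join a b hab ha hb).faceOf (new hab ha hb 3) := by
  obtain rfl | rfl | rfl | rfl : i = 0 ∨ i = 1 ∨ i = 2 ∨ i = 3 := by fin_cases i <;> simp
  · exact Or.inr (faceOf_new_zero hab ha hb)
  · exact Or.inl rfl
  · exact Or.inl (faceOf_new_two hab ha hb)
  · exact Or.inr rfl

theorem faceOf_eq_of_oldFace_eq (hf : D.faceOf a = D.faceOf b)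
    {x : (D.join a b hab ha hb).Dart} (hx : oldFace hab ha hb x = D.faceOf a) :
    (D.join a b hab ha hb).faceOf x = (D.join a b hab ha hb).faceOf (new hab ha hb 1) ∨
      (D.join a b hab ha hb).faceOf x = (D.join a b hab ha hb).faceOf (new hab ha hb 3) := by
  rcases join_cases hab ha hb x with ⟨d, rfl⟩ | ⟨i, rfl⟩
  · exact faceOf_old_of_faceOf_eq hab ha hb hf hx
  · exact faceOf_new_eq hab ha hb i

instance (E : SproutDrawing) : Finite E.Vertex := Quotient.finite _

instance (E : SproutDrawing) : Finite E.Face := Quotient.finite _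

/-- Joining two tips inside a face splits it into two faces. -/
theorem card_face_join (hf : D.faceOf a = D.faceOf b) :
    Nat.card (D.join a b hab ha hb).Face = Nat.card D.Face + 1 := by
  classical
  rw [← Finite.card_option]
  let π : (D.join a b hab ha hb).Face → D.Face := Quotient.lift (oldFace hab ha hb)
    fun x y h => oldFace_eq_of_faceOf_eq hab ha hb hf (Quotient.sound h)
  have hπ : ∀ x, π ((D.join a b hab ha hb).faceOf x) = oldFace hab ha hb x := fun _ => rfl
  have hne := faceOf_new_one_ne_new_three hab ha hb hf
  -- The side of tip `3` is the extra face; the side of tip `1` takes the place of the face that was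
  -- split.
  refine Nat.card_eq_of_bijective (fun q => if q = (D.join a b hab ha hb).faceOf (new hab ha hb 3)
    then none else some (π q)) ⟨?_, ?_⟩
  · intro q q' h
    obtain ⟨x, rfl⟩ := faceOf_surjective _ q
    obtain ⟨y, rfl⟩ := faceOf_surjective _ q'
    dsimp only at h
    split_ifs at h with h1 h2 h2
    · rw [h1, h2]
    · rw [Option.some_inj, hπ, hπ] at h
      by_cases hx : oldFace hab ha hb x = D.faceOf a
      · rw [(faceOf_eq_of_oldFace_eq hab ha hb hf hx).resolve_right h1,
          (faceOf_eq_of_oldFace_eq hab ha hb hf (h.symm.trans hx)).resolve_right h2]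
      · rcases join_cases hab ha hb x with ⟨d, rfl⟩ | ⟨i, rfl⟩
        · rcases join_cases hab ha hb y with ⟨e, rfl⟩ | ⟨j, rfl⟩
          · exact faceOf_old_eq_of_faceOf_ne hab ha hb hx (hf ▸ hx) h
          · exact absurd h hx
        · exact absurd rfl hx
  · rintro (_ | f)
    · exact ⟨_, if_pos rfl⟩
    · obtain ⟨d, rfl⟩ := faceOf_surjective _ f
      by_cases hd : D.faceOf d = D.faceOf a
      · refine ⟨(D.join a b hab ha hb).faceOf (new hab ha hb 1), ?_⟩
        simp only [if_neg hne, hπ, oldFace_new, hd]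
      · refine ⟨(D.join a b hab ha hb).faceOf (old hab ha hb d), ?_⟩
        have : (D.join a b hab ha hb).faceOf (old hab ha hb d) ≠
            (D.join a b hab ha hb).faceOf (new hab ha hb 3) := fun h =>
          hd (oldFace_eq_of_faceOf_eq hab ha hb hf h)
        simp only [if_neg this, hπ, oldFace_old]

/-- The walk leaving the curve just after `b` never meets `a`, so it runs around the whole old face
of `b` and returns to the curve through `b` on the other side. Thus the two sides merge. -/
theorem faceOf_new_one_eq_new_three (hf : D.faceOf a ≠ D.faceOf b) :
    (D.join a b hab ha hb).faceOf (new hab ha hb 1) =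
      (D.join a b hab ha hb).faceOf (new hab ha hb 3) := by
  obtain ⟨n, hn, hlt⟩ := (Equiv.Perm.SameCycle.refl D.facePerm b).exists_first_iterate
  have : ∀ i ≤ n, (D.join a b hab ha hb).faceOf (old hab ha hb (D.facePerm^[i + 1] b)) =
      (D.join a b hab ha hb).faceOf (new hab ha hb 1) := by
    intro i hi
    induction i with
    | zero => exact faceOf_old_facePerm_right hab ha hb
    | succ i ih =>
      rw [← ih (by omega), Function.iterate_succ_apply' D.facePerm, ← facePerm_old,
        faceOf_facePerm]
      · intro h
        exact hf (h ▸ faceOf_iterate D b (i + 1))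
      · exact hlt i hi
  rw [← this n le_rfl, hn, faceOf_old_right]

/-- Joining two tips that lie in different faces does not create a face. -/
theorem card_face_join_le (hf : D.faceOf a ≠ D.faceOf b) :
    Nat.card (D.join a b hab ha hb).Face ≤ Nat.card D.Face := by
  have hba := faceOf_new_one_eq_new_three hab ha hb hf
  -- Since both sides of the curve are one face, each old boundary stays within one new face; this
  -- gives a surjection from old faces to new ones.
  have key : ∀ d, (D.join a b hab ha hb).faceOf (old hab ha hb (D.facePerm d)) =
      (D.join a b hab ha hb).faceOf (old hab ha hb d) := by
    intro d
    by_cases h1 : d = a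
    · subst h1
      rw [faceOf_old_facePerm_left, faceOf_old_left, hba]
    by_cases h2 : d = b
    · subst h2
      rw [faceOf_old_facePerm_right, faceOf_old_right, hba]
    rw [← facePerm_old hab ha hb h1 h2, faceOf_facePerm]
  let g : D.Face → (D.join a b hab ha hb).Face :=
    Quotient.lift (fun d => (D.join a b hab ha hb).faceOf (old hab ha hb d)) fun d e h =>
      (mem_of_faceOf_eq (S := {z | (D.join a b hab ha hb).faceOf (old hab ha hb z) =
        (D.join a b hab ha hb).faceOf (old hab ha hb d)}) (fun z hz => (key z).trans hz)
        (Quotient.sound h) rfl).symm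
  refine Nat.card_le_card_of_surjective g fun q => ?_
  obtain ⟨x, rfl⟩ := faceOf_surjective _ q
  rcases join_cases hab ha hb x with ⟨d, rfl⟩ | ⟨i, rfl⟩
  · exact ⟨D.faceOf d, rfl⟩
  · refine ⟨D.faceOf a, (faceOf_old_left hab ha hb).trans ?_⟩
    rcases faceOf_new_eq hab ha hb i with h | h
    · exact h.symm
    · exact hba.trans h.symm

theorem card_vertex_join :
    Nat.card (D.join a b hab ha hb).Vertex = Nat.card D.Vertex + 1 := by
  rw [← Finite.card_option]
  let g : Option D.Vertex → (D.join a b hab ha hb).Vertex := fun o =>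
    o.elim ((D.join a b hab ha hb).vertexOf (new hab ha hb 0))
      (Quotient.lift (fun d => (D.join a b hab ha hb).vertexOf (old hab ha hb d)) fun d e h =>
        (vertexOf_old_eq_old hab ha hb).2 (Quotient.sound h))
  have hg : ∀ d, g (some (D.vertexOf d)) =
    (D.join a b hab ha hb).vertexOf (old hab ha hb d) := fun _ => rfl
  have hg0 : g none = (D.join a b hab ha hb).vertexOf (new hab ha hb 0) := rfl
  refine (Nat.card_eq_of_bijective g ⟨?_, ?_⟩).symm
  · rintro (_ | u) (_ | v) h
    · rfl
    · obtain ⟨d, rfl⟩ := vertexOf_surjective _ v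
      exact absurd h.symm (vertexOf_old_ne_new _ _ _)
    · obtain ⟨d, rfl⟩ := vertexOf_surjective _ u
      exact absurd h (vertexOf_old_ne_new _ _ _)
    · obtain ⟨d, rfl⟩ := vertexOf_surjective _ u
      obtain ⟨e, rfl⟩ := vertexOf_surjective _ v
      rw [hg, hg, vertexOf_old_eq_old] at h
      rw [h]
  · intro q
    obtain ⟨x, rfl⟩ := vertexOf_surjective _ q
    rcases join_cases hab ha hb x with ⟨d, rfl⟩ | ⟨i, rfl⟩
    · exact ⟨some (D.vertexOf d), rfl⟩
    · exact ⟨none, vertexOf_new_eq_new _ _ _ _ _⟩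

theorem edges_join : (D.join a b hab ha hb).edges =
    insert s(old hab ha hb a, new hab ha hb 0) (insert s(old hab ha hb b, new hab ha hb 2)
      (Sym2.map (old hab ha hb) '' D.edges)) := by
  ext e
  constructor
  · rintro ⟨x, hx, rfl⟩
    rcases join_cases hab ha hb x with ⟨d, rfl⟩ | ⟨i, rfl⟩
    · by_cases h1 : d = a
      · subst h1
        rw [mate_left]
        exact Or.inl rfl
      by_cases h2 : d = b
      · subst h2
        rw [mate_right]
        exact Or.inr (Or.inl rfl)
      rw [mate_old _ _ _ h1 h2]
      exact Or.inr (Or.inr ⟨_, ⟨d, fun h => hx ((isTip_old _ _ _).2 ⟨h, h1, h2⟩), rfl⟩, rfl⟩)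
    · rw [isTip_new] at hx
      obtain rfl | rfl : i = 0 ∨ i = 2 := by
        fin_cases i <;> simp_all
      · exact Or.inl Sym2.eq_swap
      · exact Or.inr (Or.inl Sym2.eq_swap)
  · rintro (rfl | rfl | ⟨_, ⟨d, hd, rfl⟩, rfl⟩)
    · exact ⟨old hab ha hb a, by simp [isTip_old], by rw [mate_left]⟩
    · exact ⟨old hab ha hb b, by simp [isTip_old], by rw [mate_right]⟩
    · refine ⟨old hab ha hb d, fun h => hd ((isTip_old _ _ _).1 h).1, ?_⟩
      rw [mate_old _ _ _ (fun h : d = a => hd (h ▸ ha)) (fun h : d = b => hd (h ▸ hb))]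
      rfl

theorem ncard_edges_join : (D.join a b hab ha hb).edges.ncard = D.edges.ncard + 2 := by
  have hnot : ∀ c i, s(old hab ha hb c, new hab ha hb i) ∉ Sym2.map (old hab ha hb) '' D.edges := by
    rintro c i ⟨_, ⟨d, -, rfl⟩, h⟩
    rw [Sym2.map_mk, Sym2.eq_iff] at h
    simp at h
  rw [edges_join, Set.ncard_insert_of_notMem, Set.ncard_insert_of_notMem (hnot _ _),
    Set.ncard_image_of_injective]
  · exact Sym2.map.injective Sum.inl_injective
  · rw [Set.mem_insert_iff, not_or]
    refine ⟨?_, hnot _ _⟩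
    rw [Sym2.eq_iff]
    simp [hab]

end Join

/-- A connected plane drawing of a graph of girth at least four. -/
def IsAdmissible (D : SproutDrawing) : Prop :=
  D.IsPlanarOfGirth 4 ∧ D.graph.Connected

/-- Two open tips in one face, at distinct vertices that are not adjacent. -/
structure Joinable (D : SproutDrawing) (a b : D.Dart) : Prop where
  left : D.IsTip a
  right : D.IsTip b
  face : D.faceOf a = D.faceOf b
  vertex : D.vertexOf a ≠ D.vertexOf b
  not_adj : ¬ D.graph.Adj (D.vertexOf a) (D.vertexOf b)

theorem Joinable.ne {D : SproutDrawing} {a b : D.Dart} (h : D.Joinable a b) : a ≠ b :=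
  fun hab => h.vertex (hab ▸ rfl)

theorem Joinable.symm {D : SproutDrawing} {a b : D.Dart} (h : D.Joinable a b) : D.Joinable b a :=
  ⟨h.right, h.left, h.face.symm, h.vertex.symm, fun h' => h.not_adj h'.symm⟩

/-! ### Validity of moves in a connected drawing -/

section Join

variable {D : SproutDrawing} {a b : D.Dart} (hab : a ≠ b) (ha : D.IsTip a) (hb : D.IsTip b)

theorem connected_join_of_reachable
    (h : ∀ d, (D.join a b hab ha hb).graph.Reachable
      ((D.join a b hab ha hb).vertexOf (old hab ha hb d))
      ((D.join a b hab ha hb).vertexOf (new hab ha hb 0))) :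
    (D.join a b hab ha hb).graph.Connected := by
  have key : ∀ v, (D.join a b hab ha hb).graph.Reachable v
      ((D.join a b hab ha hb).vertexOf (new hab ha hb 0)) := by
    intro v
    obtain ⟨x, rfl⟩ := vertexOf_surjective _ v
    rcases join_cases hab ha hb x with ⟨d, rfl⟩ | ⟨i, rfl⟩
    · exact h d
    · rw [vertexOf_new_eq_new hab ha hb i 0]
  exact (SimpleGraph.connected_iff _).2 ⟨fun u v => (key u).trans (key v).symm,
    ⟨(D.join a b hab ha hb).vertexOf (new hab ha hb 0)⟩⟩

theorem connected_join (hc : D.graph.Connected) : (D.join a b hab ha hb).graph.Connected := by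
  refine connected_join_of_reachable hab ha hb fun d => ?_
  have h1 : (D.join a b hab ha hb).graph.Reachable
      ((D.join a b hab ha hb).vertexOf (old hab ha hb a))
      ((D.join a b hab ha hb).vertexOf (new hab ha hb 0)) :=
    ((adj_old_new hab ha hb).2 (Or.inl rfl)).reachable
  refine SimpleGraph.Reachable.trans ?_ h1
  let g : D.graph →g (D.join a b hab ha hb).graph :=
    { toFun := Quotient.lift (fun d => (D.join a b hab ha hb).vertexOf (old hab ha hb d))
        fun d e h => (vertexOf_old_eq_old hab ha hb).2 (Quotient.sound h)
      map_rel' := by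
        intro u v huv
        obtain ⟨d, rfl⟩ := vertexOf_surjective _ u
        obtain ⟨e, rfl⟩ := vertexOf_surjective _ v
        exact (adj_old_old hab ha hb).2 huv }
  exact (hc.preconnected (D.vertexOf d) (D.vertexOf a)).map g

theorem card_connectedComponent {V : Type*} {G : SimpleGraph V} (h : G.Connected) :
    Nat.card G.ConnectedComponent = 1 :=
  Nat.card_eq_one_iff_unique.2 ⟨h.preconnected.subsingleton_connectedComponent,
    h.nonempty.map G.connectedComponentMk⟩

/-- The two new edges meet at the crossbar point, so they could be parallel only if `a` and `b` were
at one vertex. -/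
theorem IsSimple.join (hs : D.IsSimple) (hv : D.vertexOf a ≠ D.vertexOf b) :
    (D.join a b hab ha hb).IsSimple := by
  have hold : ∀ d, D.mate d ≠ d → d ≠ a ∧ d ≠ b := fun d hd =>
    ⟨fun h => hd (h ▸ ha), fun h => hd (h ▸ hb)⟩
  have hne := fun d i => vertexOf_old_ne_new hab ha hb (d := d) (i := i)
  have hnew : ∀ i, ¬ (D.join a b hab ha hb).IsTip (new hab ha hb i) → i = 0 ∨ i = 2 := by
    intro i hi
    rw [isTip_new] at hi
    fin_cases i <;> simp_all
  constructor
  · intro x hx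
    rcases join_cases hab ha hb x with ⟨d, rfl⟩ | ⟨i, rfl⟩
    · by_cases h1 : d = a
      · subst h1
        rw [mate_left]
        exact hne _ _
      by_cases h2 : d = b
      · subst h2
        rw [mate_right]
        exact hne _ _
      rw [mate_old _ _ _ h1 h2, Ne, vertexOf_old_eq_old]
      exact hs.1 d fun h => hx ((isTip_old _ _ _).2 ⟨h, h1, h2⟩)
    · obtain rfl | rfl := hnew i hx
      · rw [mate_new_zero]
        exact (hne _ _).symm
      · rw [mate_new_two]
        exact (hne _ _).symm
  · intro x y hx hy h h'
    rcases join_cases hab ha hb x with ⟨d, rfl⟩ | ⟨i, rfl⟩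
    · rcases join_cases hab ha hb y with ⟨e, rfl⟩ | ⟨j, rfl⟩
      · rw [vertexOf_old_eq_old] at h
        rw [old_inj]
        by_cases h1 : d = a
        · subst h1
          by_cases h2 : e = d
          · exact h2.symm
          by_cases h3 : e = b
          · exact absurd (h3 ▸ h) hv
          rw [mate_left, mate_old _ _ _ h2 h3] at h'
          exact absurd h'.symm (hne _ _)
        by_cases h2 : d = b
        · subst h2
          by_cases h3 : e = a
          · exact absurd (h3 ▸ h).symm hv
          by_cases h4 : e = d
          · exact h4.symm
          rw [mate_right, mate_old _ _ _ h3 h4] at h'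
          exact absurd h'.symm (hne _ _)
        rw [mate_old _ _ _ h1 h2] at h'
        by_cases h3 : e = a
        · subst h3
          rw [mate_left] at h'
          exact absurd h' (hne _ _)
        by_cases h4 : e = b
        · subst h4
          rw [mate_right] at h'
          exact absurd h' (hne _ _)
        rw [mate_old _ _ _ h3 h4, vertexOf_old_eq_old] at h'
        exact hs.2 d e (fun h => hx ((isTip_old _ _ _).2 ⟨h, h1, h2⟩))
          (fun h => hy ((isTip_old _ _ _).2 ⟨h, h3, h4⟩)) h h'
      · exact absurd h (hne _ _)
    · rcases join_cases hab ha hb y with ⟨e, rfl⟩ | ⟨j, rfl⟩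
      · exact absurd h.symm (hne _ _)
      · obtain rfl | rfl := hnew i hx <;> obtain rfl | rfl := hnew j hy
        · rfl
        · exact absurd ((vertexOf_old_eq_old hab ha hb).1 h') hv
        · exact absurd ((vertexOf_old_eq_old hab ha hb).1 h').symm hv
        · rfl

/-- A new triangle would contain the crossbar point, whose only neighbours are the vertices of `a`
and `b`. -/
theorem four_le_egirth_join (hs : (4 : ℕ∞) ≤ D.graph.egirth)
    (hadj : ¬ D.graph.Adj (D.vertexOf a) (D.vertexOf b)) :
    (4 : ℕ∞) ≤ (D.join a b hab ha hb).graph.egirth := by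
  rw [SimpleGraph.four_le_egirth_iff] at hs ⊢
  have key : ∀ d e, D.vertexOf d = D.vertexOf a ∨ D.vertexOf d = D.vertexOf b →
      D.vertexOf e = D.vertexOf a ∨ D.vertexOf e = D.vertexOf b →
      ¬ D.graph.Adj (D.vertexOf d) (D.vertexOf e) := by
    rintro d e (hd | hd) (he | he) h <;> rw [hd, he] at h
    · exact h.ne rfl
    · exact hadj h
    · exact hadj h.symm
    · exact h.ne rfl
  intro u v w huv hvw huw
  obtain ⟨x, rfl⟩ := vertexOf_surjective _ u
  obtain ⟨y, rfl⟩ := vertexOf_surjective _ v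
  obtain ⟨z, rfl⟩ := vertexOf_surjective _ w
  rcases join_cases hab ha hb x with ⟨d, rfl⟩ | ⟨i, rfl⟩ <;>
  rcases join_cases hab ha hb y with ⟨e, rfl⟩ | ⟨j, rfl⟩ <;>
  rcases join_cases hab ha hb z with ⟨f, rfl⟩ | ⟨k, rfl⟩ <;>
  try simp only [adj_old_old, adj_new_old, adj_old_new] at huv hvw huw
  · exact hs _ _ _ huv hvw huw
  · exact key _ _ huw hvw huv
  · exact key _ _ huv hvw huw
  · exact hvw.ne (vertexOf_new_eq_new _ _ _ _ _)
  · exact key _ _ huv huw hvw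
  · exact huw.ne (vertexOf_new_eq_new _ _ _ _ _)
  · exact huv.ne (vertexOf_new_eq_new _ _ _ _ _)
  · exact huw.ne (vertexOf_new_eq_new _ _ _ _ _)

/-- Euler's formula persists: one more vertex, one more face, two more edges, still one component.
-/
theorem IsAdmissible.join (hD : D.IsAdmissible) (h : D.Joinable a b) :
    (D.join a b hab ha hb).IsAdmissible := by
  obtain ⟨⟨hp, hs, hg⟩, hc⟩ := hD
  have hc' := connected_join hab ha hb hc
  refine ⟨⟨?_, hs.join hab ha hb h.vertex, four_le_egirth_join hab ha hb hg h.not_adj⟩, hc'⟩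
  unfold IsPlanar at hp ⊢
  rw [card_connectedComponent hc] at hp
  rw [card_connectedComponent hc', card_vertex_join, card_face_join _ _ _ h.face,
    ncard_edges_join]
  omega

theorem vertexOf_ne_of_isSimple_join (hs : (D.join a b hab ha hb).IsSimple) :
    D.vertexOf a ≠ D.vertexOf b := by
  intro h
  have := hs.2 (new hab ha hb 0) (new hab ha hb 2) (by simp [isTip_new]) (by simp [isTip_new])
    (vertexOf_new_eq_new _ _ _ _ _) ((vertexOf_old_eq_old hab ha hb).2 h)
  simp at this

/-- With tips in different faces the number of faces would not grow, while `V - E` drops by one,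
against Euler's formula. -/
theorem IsAdmissible.joinable (hD : D.IsAdmissible)
    (h : (D.join a b hab ha hb).IsPlanarOfGirth 4) : D.Joinable a b := by
  obtain ⟨⟨hp, hs, hg⟩, hc⟩ := hD
  obtain ⟨hp', hs', hg'⟩ := h
  have hc' := connected_join hab ha hb hc
  refine ⟨ha, hb, ?_, vertexOf_ne_of_isSimple_join hab ha hb hs', ?_⟩
  · by_contra hf
    have := card_face_join_le hab ha hb hf
    unfold IsPlanar at hp hp'
    rw [card_connectedComponent hc] at hp
    rw [card_connectedComponent hc', card_vertex_join, ncard_edges_join] at hp'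
    omega
  · intro hadj
    exact SimpleGraph.four_le_egirth_iff.1 hg' _ _ _
      ((adj_new_old hab ha hb (i := 0)).2 (Or.inl rfl)) ((adj_old_old hab ha hb).2 hadj)
      ((adj_new_old hab ha hb).2 (Or.inr rfl))

end Join

theorem Joinable.move {D : SproutDrawing} {a b : D.Dart} (h : D.Joinable a b)
    (hD : D.IsAdmissible) : Move 4 D (D.join a b h.ne h.left h.right) :=
  ⟨a, b, h.ne, h.left, h.right, rfl, (hD.join _ _ _ h).1⟩

theorem IsAdmissible.exists_joinable_of_move {D E : SproutDrawing} (hD : D.IsAdmissible)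
    (hm : Move 4 D E) : ∃ (a b : D.Dart) (h : D.Joinable a b), E = D.join a b h.ne h.left h.right := by
  obtain ⟨a, b, hab, ha, hb, rfl, hE⟩ := hm
  exact ⟨a, b, hD.joinable hab ha hb hE, rfl⟩

/-- Walking along the face boundary from `c` to `w`, one meets no open tip in between. -/
def EmptyArc (D : SproutDrawing) (c w : D.Dart) : Prop :=
  ∃ n, D.facePerm^[n + 1] c = w ∧ ∀ i < n, ¬ D.IsTip (D.facePerm^[i + 1] c)

/-- The face of `c` and `w` has further open tips, all at one vertex adjacent to those of `c` and
`w`, and they all lie on the same side of a curve joining `c` and `w`. -/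
structure Forced (D : SproutDrawing) (c w : D.Dart) : Prop where
  exists_tip : ∃ d, D.IsTip d ∧ D.faceOf d = D.faceOf c ∧ d ≠ c ∧ d ≠ w
  adj : ∀ d, D.IsTip d → D.faceOf d = D.faceOf c → d ≠ c → d ≠ w →
    D.graph.Adj (D.vertexOf d) (D.vertexOf c) ∧ D.graph.Adj (D.vertexOf d) (D.vertexOf w)
  vertex : ∀ d e, D.IsTip d → D.faceOf d = D.faceOf c → d ≠ c → d ≠ w →
    D.IsTip e → D.faceOf e = D.faceOf c → e ≠ c → e ≠ w → D.vertexOf d = D.vertexOf e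
  arc : D.EmptyArc c w ∨ D.EmptyArc w c

/-! ### Forced pairs: persistence in other faces and the reply to a forced move -/

section Join

variable {D : SproutDrawing} {a b : D.Dart} (hab : a ≠ b) (ha : D.IsTip a) (hb : D.IsTip b)

theorem facePerm_iterate_old {c : D.Dart} (hca : D.faceOf c ≠ D.faceOf a)
    (hcb : D.faceOf c ≠ D.faceOf b) (n : ℕ) :
    (D.join a b hab ha hb).facePerm^[n] (old hab ha hb c) = old hab ha hb (D.facePerm^[n] c) := by
  induction n with
  | zero => rfl
  | succ n ih =>
    rw [Function.iterate_succ_apply', ih, Function.iterate_succ_apply', facePerm_old]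
    · intro h
      exact hca (by rw [← h, faceOf_iterate])
    · intro h
      exact hcb (by rw [← h, faceOf_iterate])

theorem EmptyArc.join {c w : D.Dart} (h : D.EmptyArc c w) (hca : D.faceOf c ≠ D.faceOf a)
    (hcb : D.faceOf c ≠ D.faceOf b) :
    (D.join a b hab ha hb).EmptyArc (old hab ha hb c) (old hab ha hb w) := by
  obtain ⟨n, hn, hlt⟩ := h
  refine ⟨n, by rw [facePerm_iterate_old _ _ _ hca hcb, hn], fun i hi => ?_⟩
  rw [facePerm_iterate_old _ _ _ hca hcb, isTip_old]
  exact fun h => hlt i hi h.1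

theorem eq_old_of_oldFace_ne {x : (D.join a b hab ha hb).Dart}
    (hx : oldFace hab ha hb x ≠ D.faceOf a) : ∃ d, x = old hab ha hb d :=
  (join_cases hab ha hb x).resolve_right fun ⟨_, h⟩ => hx (h ▸ rfl)

/-- A move in another face alters neither the boundary walk nor the tips of this one, nor adjacency
between old vertices. -/
theorem Forced.join (hf : D.faceOf a = D.faceOf b) {c w : D.Dart} (h : D.Forced c w)
    (hcw : D.faceOf c = D.faceOf w) (hca : D.faceOf c ≠ D.faceOf a) :
    (D.join a b hab ha hb).Forced (old hab ha hb c) (old hab ha hb w) := by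
  have hcb : D.faceOf c ≠ D.faceOf b := hf ▸ hca
  have key : ∀ x, (D.join a b hab ha hb).IsTip x →
      (D.join a b hab ha hb).faceOf x = (D.join a b hab ha hb).faceOf (old hab ha hb c) →
      ∃ d, x = old hab ha hb d ∧ D.IsTip d ∧ D.faceOf d = D.faceOf c := by
    intro x hx hxc
    have hxc' := oldFace_eq_of_faceOf_eq hab ha hb hf hxc
    obtain ⟨d, rfl⟩ := eq_old_of_oldFace_ne hab ha hb (fun h => hca (hxc'.symm.trans h))
    exact ⟨d, rfl, ((isTip_old _ _ _).1 hx).1, hxc'⟩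
  constructor
  · obtain ⟨d, hd, hdc, h1, h2⟩ := h.exists_tip
    refine ⟨old hab ha hb d, (isTip_old _ _ _).2 ⟨hd, ?_, ?_⟩, ?_, by simpa, by simpa⟩
    · rintro rfl
      exact hca hdc.symm
    · rintro rfl
      exact hcb hdc.symm
    · exact (faceOf_old_eq_of_faceOf_ne hab ha hb hca hcb hdc.symm).symm
  · intro x hx hxc h1 h2
    obtain ⟨d, rfl, hd, hdc⟩ := key x hx hxc
    rw [adj_old_old, adj_old_old]
    exact h.adj d hd hdc (by simpa using h1) (by simpa using h2)
  · intro x y hx hxc h1 h2 hy hyc h3 h4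
    obtain ⟨d, rfl, hd, hdc⟩ := key x hx hxc
    obtain ⟨e, rfl, he, hec⟩ := key y hy hyc
    rw [vertexOf_old_eq_old]
    exact h.vertex d e hd hdc (by simpa using h1) (by simpa using h2) he hec (by simpa using h3)
      (by simpa using h4)
  · exact h.arc.imp (fun h => h.join hab ha hb hca hcb)
      (fun h => h.join hab ha hb (hcw ▸ hca) (hcw ▸ hcb))

/-- A pair that can be joined after a move and lies outside the face of this move could be joined
before. -/
theorem Joinable.of_join (hf : D.faceOf a = D.faceOf b) {x y : (D.join a b hab ha hb).Dart}
    (h : (D.join a b hab ha hb).Joinable x y) (hx : oldFace hab ha hb x ≠ D.faceOf a) :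
    ∃ c w, x = old hab ha hb c ∧ y = old hab ha hb w ∧ D.Joinable c w ∧
      D.faceOf c ≠ D.faceOf a := by
  have hxy := oldFace_eq_of_faceOf_eq hab ha hb hf h.face
  obtain ⟨c, rfl⟩ := eq_old_of_oldFace_ne hab ha hb hx
  obtain ⟨w, rfl⟩ := eq_old_of_oldFace_ne hab ha hb (hxy ▸ hx)
  refine ⟨c, w, rfl, rfl, ⟨((isTip_old _ _ _).1 h.left).1, ((isTip_old _ _ _).1 h.right).1, hxy,
    ?_, ?_⟩, hx⟩
  · exact fun h' => h.vertex ((vertexOf_old_eq_old _ _ _).2 h')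
  · exact fun h' => h.not_adj ((adj_old_old _ _ _).2 h')

/-- If all open tips of a face except for `a` are at the same vertex, then after joining `a` to one
of them, this face is exhausted. -/
theorem oldFace_ne_of_joinable_join (hf : D.faceOf a = D.faceOf b)
    (hv : ∀ e, D.IsTip e → D.faceOf e = D.faceOf a → e ≠ a → D.vertexOf e = D.vertexOf b)
    {x y : (D.join a b hab ha hb).Dart} (h : (D.join a b hab ha hb).Joinable x y) :
    oldFace hab ha hb x ≠ D.faceOf a := by
  intro hx
  have hy : oldFace hab ha hb y = D.faceOf a :=
    (oldFace_eq_of_faceOf_eq hab ha hb hf h.face).symm.trans hx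
  have key : ∀ e, (D.join a b hab ha hb).IsTip (old hab ha hb e) →
      oldFace hab ha hb (old hab ha hb e) = D.faceOf a → D.vertexOf e = D.vertexOf b := by
    intro e he hea
    rw [isTip_old] at he
    exact hv e he.1 hea he.2.1
  have h1 := h.vertex
  have h2 := h.not_adj
  rcases join_cases hab ha hb x with ⟨d, rfl⟩ | ⟨i, rfl⟩ <;>
  rcases join_cases hab ha hb y with ⟨e, rfl⟩ | ⟨j, rfl⟩
  · rw [Ne, vertexOf_old_eq_old, key d h.left hx, key e h.right hy] at h1
    exact h1 rfl
  · rw [adj_old_new] at h2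
    exact h2 (Or.inr (key d h.left hx))
  · rw [adj_new_old] at h2
    exact h2 (Or.inr (key e h.right hy))
  · exact h1 (vertexOf_new_eq_new _ _ _ _ _)

/-- After the forced move in a face, one of its two parts contains only one tip, and in the other
one all tips except for a new one, `x`, are at the same vertex. -/
theorem Forced.exists_reply (hj : D.Joinable a b) (h : D.Forced a b) :
    ∃ x d, (D.join a b hab ha hb).Joinable x d ∧ oldFace hab ha hb x = D.faceOf a ∧
      (∀ e, (D.join a b hab ha hb).IsTip e →
        (D.join a b hab ha hb).faceOf e = (D.join a b hab ha hb).faceOf x → e ≠ x →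
        (D.join a b hab ha hb).vertexOf e = (D.join a b hab ha hb).vertexOf d) ∧
      ∀ y z, (D.join a b hab ha hb).Joinable y z → oldFace hab ha hb y = D.faceOf a →
        (D.join a b hab ha hb).faceOf y = (D.join a b hab ha hb).faceOf x := by
  have hne := faceOf_new_one_ne_new_three hab ha hb hj.face
  -- The crossbar tip `j` is the one alone on the side cut off by the empty arc; `i` is the tip
  -- facing the remaining tips of the face.
  obtain ⟨i, j, hij, hj'⟩ : ∃ i j : Fin 4, (i = 1 ∧ j = 3 ∨ i = 3 ∧ j = 1) ∧
      ∀ y, (D.join a b hab ha hb).IsTip y → (D.join a b hab ha hb).faceOf y =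
        (D.join a b hab ha hb).faceOf (new hab ha hb j) → y = new hab ha hb j := by
    rcases h.arc with ⟨n, hn, hlt⟩ | ⟨n, hn, hlt⟩
    · refine ⟨1, 3, Or.inl ⟨rfl, rfl⟩, fun y hy hy3 => ?_⟩
      obtain rfl | rfl | rfl | ⟨i, hi, rfl⟩ := mem_of_faceOf_eq_new_three hab ha hb hn
        (fun i hi => ⟨fun h => hlt i hi (by rwa [h]), fun h => hlt i hi (by rwa [h])⟩) hy3
      · rfl
      · simp [isTip_new] at hy
      · simp [isTip_old] at hy
      · exact absurd ((isTip_old _ _ _).1 hy).1 (hlt i hi)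
    · refine ⟨3, 1, Or.inr ⟨rfl, rfl⟩, fun y hy hy1 => ?_⟩
      obtain rfl | rfl | rfl | ⟨i, hi, rfl⟩ := mem_of_faceOf_eq_new_one hab ha hb hn
        (fun i hi => ⟨fun h => hlt i hi (by rwa [h]), fun h => hlt i hi (by rwa [h])⟩) hy1
      · rfl
      · simp [isTip_new] at hy
      · simp [isTip_old] at hy
      · exact absurd ((isTip_old _ _ _).1 hy).1 (hlt i hi)
  have hi : (D.join a b hab ha hb).IsTip (new hab ha hb i) :=
    (isTip_new _ _ _).2 (hij.imp And.left And.left)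
  have hij' : (D.join a b hab ha hb).faceOf (new hab ha hb i) ≠
      (D.join a b hab ha hb).faceOf (new hab ha hb j) := by
    rcases hij with ⟨rfl, rfl⟩ | ⟨rfl, rfl⟩
    · exact hne
    · exact hne.symm
  have hface : ∀ y, (D.join a b hab ha hb).IsTip y → y ≠ new hab ha hb j →
      oldFace hab ha hb y = D.faceOf a →
      (D.join a b hab ha hb).faceOf y = (D.join a b hab ha hb).faceOf (new hab ha hb i) := by
    intro y hy hyj hya
    have := faceOf_eq_of_oldFace_eq hab ha hb hj.face hya
    rcases hij with ⟨rfl, rfl⟩ | ⟨rfl, rfl⟩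
    · exact this.resolve_right fun h => hyj (hj' y hy h)
    · exact this.resolve_left fun h => hyj (hj' y hy h)
  obtain ⟨d, hd, hda, hd1, hd2⟩ := h.exists_tip
  have hdtip : (D.join a b hab ha hb).IsTip (old hab ha hb d) :=
    (isTip_old _ _ _).2 ⟨hd, hd1, hd2⟩
  refine ⟨new hab ha hb i, old hab ha hb d, ⟨hi, hdtip, ?_, ?_, ?_⟩, rfl, ?_, ?_⟩
  · exact (hface _ hdtip (by simp) hda).symm
  · exact (vertexOf_old_ne_new _ _ _).symm
  -- The new point is adjacent only to the vertices of `a` and `b`, and the vertex of `d`, being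
  -- adjacent to both, is neither of them.
  · rw [adj_new_old]
    rintro (h' | h')
    · exact (h.adj d hd hda hd1 hd2).1.ne h'
    · exact (h.adj d hd hda hd1 hd2).2.ne h'
  · intro e he hei hne
    have hea := oldFace_eq_of_faceOf_eq hab ha hb hj.face hei
    rcases join_cases hab ha hb e with ⟨e, rfl⟩ | ⟨k, rfl⟩
    · rw [vertexOf_old_eq_old]
      have he' := (isTip_old _ _ _).1 he
      exact h.vertex e d he'.1 hea he'.2.1 he'.2.2 hd hda hd1 hd2
    · have : k = i ∨ k = j := by
        rw [isTip_new] at he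
        omega
      rcases this with rfl | rfl
      · exact absurd rfl hne
      · exact absurd hei.symm hij'
  · intro y z hyz hy
    by_cases hyj : y = new hab ha hb j
    · subst hyj
      exact absurd (hj' z hyz.right hyz.face.symm).symm hyz.ne
    · exact hface y hyz.left hyj hy

end Join

/-- Every possible move is forced in its face. -/
def AllForced (D : SproutDrawing) : Prop :=
  D.IsAdmissible ∧ ∀ c w, D.Joinable c w → D.Forced c w

/-- The termination measure. The darts themselves only grow in number during play. -/
def joinablePairs (D : SproutDrawing) : Set (D.Dart × D.Dart) :=
  {p | D.Joinable p.1 p.2}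

/-- The reply exhausts the face of the forced move. Every pair still joinable comes from a joinable
pair in another face, which both moves leave intact. -/
theorem AllForced.exists_reply {D E : SproutDrawing} (hD : D.AllForced) (hm : Move 4 D E) :
    ∃ R, Move 4 E R ∧ R.AllForced ∧ R.joinablePairs.ncard < D.joinablePairs.ncard := by
  obtain ⟨a, b, hj, rfl⟩ := hD.1.exists_joinable_of_move hm
  have hE := hD.1.join hj.ne hj.left hj.right hj
  obtain ⟨x, d, hxd, hxa, hvx, hother⟩ :=
    (hD.2 a b hj).exists_reply hj.ne hj.left hj.right hj
  have key : ∀ y z, ((D.join a b hj.ne hj.left hj.right).join x d hxd.ne hxd.left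
      hxd.right).Joinable y z → ∃ c w,
        y = old hxd.ne hxd.left hxd.right (old hj.ne hj.left hj.right c) ∧
        z = old hxd.ne hxd.left hxd.right (old hj.ne hj.left hj.right w) ∧ D.Joinable c w ∧
        D.faceOf c ≠ D.faceOf a ∧ (D.join a b hj.ne hj.left hj.right).faceOf
          (old hj.ne hj.left hj.right c) ≠ (D.join a b hj.ne hj.left hj.right).faceOf x := by
    intro y z hyz
    obtain ⟨y, z, rfl, rfl, hyz', hyx⟩ := hyz.of_join _ _ _ hxd.face
      (oldFace_ne_of_joinable_join _ _ _ hxd.face hvx hyz)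
    obtain ⟨c, w, rfl, rfl, hcw, hca⟩ := hyz'.of_join _ _ _ hj.face
      (fun h => hyx (hother _ _ hyz' h))
    exact ⟨c, w, rfl, rfl, hcw, hca, hyx⟩
  refine ⟨_, hxd.move hE, ⟨hE.join _ _ _ hxd, fun y z hyz => ?_⟩, ?_⟩
  · obtain ⟨c, w, rfl, rfl, hcw, hca, hcx⟩ := key y z hyz
    refine Forced.join _ _ _ hxd.face ((hD.2 c w hcw).join _ _ _ hj.face hcw.face hca) ?_ hcx
    exact faceOf_old_eq_of_faceOf_ne _ _ _ hca (hj.face ▸ hca) hcw.face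
  · let ι := Prod.map (old hxd.ne hxd.left hxd.right ∘ old hj.ne hj.left hj.right)
      (old hxd.ne hxd.left hxd.right ∘ old hj.ne hj.left hj.right)
    -- The surviving pairs embed in the old ones, and `(a, b)` is lost because its own face is
    -- exhausted.
    calc _ ≤ (ι '' (D.joinablePairs \ {(a, b)})).ncard := by
          refine Set.ncard_le_ncard ?_ (Set.toFinite _)
          rintro ⟨y, z⟩ hyz
          obtain ⟨c, w, rfl, rfl, hcw, hca, -⟩ := key y z hyz
          refine ⟨(c, w), ⟨hcw, ?_⟩, rfl⟩
          rintro ⟨⟩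
          exact hca rfl
      _ ≤ (D.joinablePairs \ {(a, b)}).ncard := Set.ncard_image_le (Set.toFinite _)
      _ < D.joinablePairs.ncard :=
          Set.ncard_sdiff_singleton_lt_of_mem (show (a, b) ∈ D.joinablePairs from hj)
            (Set.toFinite _)

theorem Forced.symm {D : SproutDrawing} {c w : D.Dart} (h : D.Forced c w)
    (hf : D.faceOf c = D.faceOf w) : D.Forced w c where
  exists_tip := by
    obtain ⟨d, h1, h2, h3, h4⟩ := h.exists_tip
    exact ⟨d, h1, h2.trans hf, h4, h3⟩
  adj d h1 h2 h3 h4 := (h.adj d h1 (h2.trans hf.symm) h4 h3).symm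
  vertex d e h1 h2 h3 h4 h5 h6 h7 h8 :=
    h.vertex d e h1 (h2.trans hf.symm) h4 h3 h5 (h6.trans hf.symm) h8 h7
  arc := h.arc.symm

theorem EmptyArc.faceOf_eq {D : SproutDrawing} {c w : D.Dart} (h : D.EmptyArc c w) :
    D.faceOf c = D.faceOf w := by
  obtain ⟨n, rfl, -⟩ := h
  rw [faceOf_iterate]

/-- A criterion for the possible moves inside a union `S` of faces to be forced. -/
theorem Joinable.forced_of_mem {D : SproutDrawing} {S : Set D.Dart} {c w d : D.Dart}
    (hS : ∀ x ∈ S, D.facePerm x ∈ S) (hc : c ∈ S) (hd : D.IsTip d) (hdw : D.faceOf d = D.faceOf w)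
    (htip : ∀ x ∈ S, D.IsTip x → x = c ∨ x = w ∨ D.vertexOf x = D.vertexOf d)
    (hadjc : D.graph.Adj (D.vertexOf d) (D.vertexOf c))
    (hadjw : D.graph.Adj (D.vertexOf d) (D.vertexOf w)) (harc : D.EmptyArc c w)
    {y z : D.Dart} (h : D.Joinable y z) (hy : y ∈ S) : D.Forced y z := by
  have hz : z ∈ S := mem_of_faceOf_eq hS h.face hy
  have key : ∀ x, D.IsTip x → D.faceOf x = D.faceOf c → x ≠ c → x ≠ w →
      D.vertexOf x = D.vertexOf d := fun x hx hxc h1 h2 =>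
    ((htip x (mem_of_faceOf_eq hS hxc.symm hc) hx).resolve_left h1).resolve_left h2
  have hcw : D.Forced c w :=
    { exists_tip := ⟨d, hd, hdw.trans harc.faceOf_eq.symm, fun h => hadjc.ne (h ▸ rfl),
        fun h => hadjw.ne (h ▸ rfl)⟩
      adj := fun x hx hxc h1 h2 => by
        rw [key x hx hxc h1 h2]
        exact ⟨hadjc, hadjw⟩
      vertex := fun x x' hx hxc h1 h2 hx' hxc' h3 h4 => by
        rw [key x hx hxc h1 h2, key x' hx' hxc' h3 h4]
      arc := Or.inl harc }
  have h1 := h.vertex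
  have h2 := h.not_adj
  -- There are three classes of tips: `c`, `w` and those at the vertex of `d`. Two tips of one class
  -- share a vertex, and the third class is adjacent to the other two, so only `c` with `w`, in
  -- either order, remains.
  rcases htip y hy h.left with rfl | rfl | hyd <;> rcases htip z hz h.right with rfl | rfl | hzd
  · exact absurd rfl h1
  · exact hcw
  · exact absurd (hzd ▸ hadjc.symm) h2
  · exact hcw.symm harc.faceOf_eq
  · exact absurd rfl h1
  · exact absurd (hzd ▸ hadjw.symm) h2
  · exact absurd (hyd ▸ hadjc) h2
  · exact absurd (hyd ▸ hadjw) h2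
  · exact absurd (hyd.trans hzd.symm) h1

/-! ### The opening move and the answer to it -/

section Opening

variable {D : SproutDrawing} {a b : D.Dart}

/-- Without edges, the face walk merely circles a single spot. -/
theorem facePerm_eq_rot (htip : ∀ d, D.IsTip d) (d : D.Dart) : D.facePerm d = D.rot d :=
  congrArg D.rot (htip d)

theorem vertexOf_eq_of_faceOf_eq (htip : ∀ d, D.IsTip d) {d e : D.Dart}
    (h : D.faceOf d = D.faceOf e) : D.vertexOf d = D.vertexOf e := by
  rw [faceOf_eq_iff, Equiv.ext (facePerm_eq_rot htip)] at h
  exact vertexOf_eq_iff.2 h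

/-- The starting position is disconnected, so `IsAdmissible.join` does not apply; planarity comes
from the validity of the move, and the crossbar point connects everything. -/
theorem isAdmissible_join_of_isTip (hab : a ≠ b) (ha : D.IsTip a) (hb : D.IsTip b)
    (hall : ∀ d, D.vertexOf d = D.vertexOf a ∨ D.vertexOf d = D.vertexOf b)
    (hp : (D.join a b hab ha hb).IsPlanarOfGirth 4) :
    (D.join a b hab ha hb).IsAdmissible :=
  ⟨hp, connected_join_of_reachable hab ha hb fun d =>
    ((adj_old_new hab ha hb).2 (hall d)).reachable⟩

theorem rot_ne_of_vertexOf_ne (hv : D.vertexOf a ≠ D.vertexOf b) : D.rot a ≠ b := by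
  intro h
  exact hv (by rw [← h, vertexOf_rot])

/-- The tips next to those used in the first move can be joined. -/
theorem joinable_rot_rot (hab : a ≠ b) (htip : ∀ d, D.IsTip d)
    (hv : D.vertexOf a ≠ D.vertexOf b) (hrot : ∀ d, D.rot d ≠ d) :
    (D.join a b hab (htip a) (htip b)).Joinable (old hab (htip a) (htip b) (D.rot a))
      (old hab (htip a) (htip b) (D.rot b)) where
  left := (isTip_old _ _ _).2 ⟨htip _, hrot a, rot_ne_of_vertexOf_ne hv⟩
  right := (isTip_old _ _ _).2 ⟨htip _, rot_ne_of_vertexOf_ne hv.symm, hrot b⟩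
  face := by
    rw [← facePerm_eq_rot htip, ← facePerm_eq_rot htip, faceOf_old_facePerm_left,
      faceOf_old_facePerm_right, faceOf_new_one_eq_new_three]
    exact fun h => hv (vertexOf_eq_of_faceOf_eq htip h)
  vertex := by
    rwa [Ne, vertexOf_old_eq_old, vertexOf_rot, vertexOf_rot]
  not_adj := by
    rw [adj_old_old]
    rintro ⟨-, d, hd, -⟩
    exact hd (htip d)

/-- After the opening move and the answer to it, every move is forced. -/
theorem forced_of_joinable_opening (hab : a ≠ b) (htip : ∀ d, D.IsTip d)
    (hv : D.vertexOf a ≠ D.vertexOf b)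
    (hall : ∀ d, D.vertexOf d = D.vertexOf a ∨ D.vertexOf d = D.vertexOf b)
    (hrot : ∀ d, D.rot d ≠ d) (hrot2 : ∀ d, D.rot (D.rot d) ≠ d)
    (hne : old hab (htip a) (htip b) (D.rot a) ≠ old hab (htip a) (htip b) (D.rot b))
    (ha' : (D.join a b hab (htip a) (htip b)).IsTip (old hab (htip a) (htip b) (D.rot a)))
    (hb' : (D.join a b hab (htip a) (htip b)).IsTip (old hab (htip a) (htip b) (D.rot b)))
    {y z : ((D.join a b hab (htip a) (htip b)).join _ _ hne ha' hb').Dart}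
    (h : ((D.join a b hab (htip a) (htip b)).join _ _ hne ha' hb').Joinable y z) :
    ((D.join a b hab (htip a) (htip b)).join _ _ hne ha' hb').Forced y z := by
  -- Lower case refers to the first move and upper case to the answer: `o`, `O` embed earlier darts,
  -- while `n`, `N` are the darts at the two crossbar points.
  set o := old hab (htip a) (htip b) with ho
  set n := new hab (htip a) (htip b) with hn
  have hoi : ∀ d e, o d = o e ↔ d = e := fun d e => old_inj _ _ _
  have hno : ∀ d i, n i ≠ o d := fun d i => new_ne_old _ _ _
  have hface : ∀ d, d ≠ a → d ≠ b → (D.join a b hab (htip a) (htip b)).facePerm (o d) =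
      o (D.rot d) := fun d h1 h2 => by
    rw [ho, facePerm_old _ _ _ h1 h2, facePerm_eq_rot htip]
  have hab' : ∀ {d}, D.vertexOf d = D.vertexOf b → d ≠ a := fun h h' => hv (h' ▸ h)
  have hba' : ∀ {d}, D.vertexOf d = D.vertexOf a → d ≠ b := fun h h' => hv (h' ▸ h).symm
  have hra := D.vertexOf_rot a
  have hrb := D.vertexOf_rot b
  have hrra : D.vertexOf (D.rot (D.rot a)) = D.vertexOf a := by rw [vertexOf_rot, hra]
  have hrrb : D.vertexOf (D.rot (D.rot b)) = D.vertexOf b := by rw [vertexOf_rot, hrb]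
  have hab2 : ∀ {d}, D.vertexOf d = D.vertexOf b → d ≠ D.rot a := fun h h' =>
    hv ((h' ▸ h : D.vertexOf (D.rot a) = _) ▸ hra).symm
  have hba2 : ∀ {d}, D.vertexOf d = D.vertexOf a → d ≠ D.rot b := fun h h' =>
    hv ((h' ▸ h : D.vertexOf (D.rot b) = _) ▸ hrb)
  have hn0 : (D.join a b hab (htip a) (htip b)).facePerm (n 0) = o (D.rot a) := by
    rw [hn, facePerm_new_zero, facePerm_eq_rot htip]
  have hn1 : (D.join a b hab (htip a) (htip b)).facePerm (n 1) = n 2 := facePerm_new_one _ _ _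
  have hn2 : (D.join a b hab (htip a) (htip b)).facePerm (n 2) = o (D.rot b) := by
    rw [hn, facePerm_new_two, facePerm_eq_rot htip]
  have hn3 : (D.join a b hab (htip a) (htip b)).facePerm (n 3) = n 0 := facePerm_new_three _ _ _
  have hoa : (D.join a b hab (htip a) (htip b)).facePerm (o a) = n 1 := facePerm_left _ _ _
  have hob : (D.join a b hab (htip a) (htip b)).facePerm (o b) = n 3 := facePerm_right _ _ _
  set O := old hne ha' hb' with hO
  set N := new hne ha' hb' with hN
  have hfO : ∀ d, d ≠ o (D.rot a) → d ≠ o (D.rot b) →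
      ((D.join a b hab (htip a) (htip b)).join _ _ hne ha' hb').facePerm (O d) =
        O ((D.join a b hab (htip a) (htip b)).facePerm d) := fun d => facePerm_old _ _ _
  have hN0 : ((D.join a b hab (htip a) (htip b)).join _ _ hne ha' hb').facePerm (N 0) =
      O (o (D.rot (D.rot a))) := by
    rw [hN, facePerm_new_zero, hface _ (hrot a) (hba' hra)]
  have hN1 : ((D.join a b hab (htip a) (htip b)).join _ _ hne ha' hb').facePerm (N 1) = N 2 :=
    facePerm_new_one _ _ _
  have hN2 : ((D.join a b hab (htip a) (htip b)).join _ _ hne ha' hb').facePerm (N 2) =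
      O (o (D.rot (D.rot b))) := by
    rw [hN, facePerm_new_two, hface _ (hab' hrb) (hrot b)]
  have hN3 : ((D.join a b hab (htip a) (htip b)).join _ _ hne ha' hb').facePerm (N 3) = N 0 :=
    facePerm_new_three _ _ _
  have hOa : ((D.join a b hab (htip a) (htip b)).join _ _ hne ha' hb').facePerm
      (O (o (D.rot a))) = N 1 := facePerm_left _ _ _
  have hOb : ((D.join a b hab (htip a) (htip b)).join _ _ hne ha' hb').facePerm
      (O (o (D.rot b))) = N 3 := facePerm_right _ _ _
  have htO : ∀ d, ((D.join a b hab (htip a) (htip b)).join _ _ hne ha' hb').IsTip (O (o d)) ↔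
      (d ≠ a ∧ d ≠ b) ∧ d ≠ D.rot a ∧ d ≠ D.rot b := fun d => by
    rw [hO, isTip_old, ho, isTip_old]
    simp [htip]
  have htn : ∀ i, ((D.join a b hab (htip a) (htip b)).join _ _ hne ha' hb').IsTip (O (n i)) ↔
      i = 1 ∨ i = 3 := fun i =>
    (isTip_old _ _ _).trans ((and_iff_left ⟨hno _ _, hno _ _⟩).trans (isTip_new _ _ _))
  have htN : ∀ i, ((D.join a b hab (htip a) (htip b)).join _ _ hne ha' hb').IsTip (N i) ↔
      i = 1 ∨ i = 3 := fun i => isTip_new _ _ _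
  have hvO : ∀ d e, ((D.join a b hab (htip a) (htip b)).join _ _ hne ha' hb').vertexOf (O (o d)) =
      ((D.join a b hab (htip a) (htip b)).join _ _ hne ha' hb').vertexOf (O (o e)) ↔
      D.vertexOf d = D.vertexOf e := fun d e => by
    rw [hO, vertexOf_old_eq_old, ho, vertexOf_old_eq_old]
  have hadjn : ∀ d i, ((D.join a b hab (htip a) (htip b)).join _ _ hne ha' hb').graph.Adj
      (((D.join a b hab (htip a) (htip b)).join _ _ hne ha' hb').vertexOf (O (o d)))
      (((D.join a b hab (htip a) (htip b)).join _ _ hne ha' hb').vertexOf (O (n i))) :=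
    fun d i => (adj_old_old _ _ _).2 ((adj_old_new _ _ _).2 (hall d))
  have hadjN : ∀ d i, ((D.join a b hab (htip a) (htip b)).join _ _ hne ha' hb').graph.Adj
      (((D.join a b hab (htip a) (htip b)).join _ _ hne ha' hb').vertexOf (O (o d)))
      (((D.join a b hab (htip a) (htip b)).join _ _ hne ha' hb').vertexOf (N i)) :=
    fun d i => (adj_old_new _ _ _).2 ((hall d).imp
      (fun h => (vertexOf_old_eq_old _ _ _).2 (h.trans hra.symm))
      (fun h => (vertexOf_old_eq_old _ _ _).2 (h.trans hrb.symm)))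
  -- These are the two sides of the 4-cycle. The first is walked as `N 1`, `N 2`, the arms at the
  -- spot of `b` from `rot (rot b)` round to `b`, then `n 3`, `n 0`, `rot a` and back to `N 1`. The
  -- second exchanges `a` with `b` and `1`, `2` with `3`, `0`.
  have hcases : y ∈ ({x | x = N 1 ∨ x = N 2 ∨ x = O (n 3) ∨ x = O (n 0) ∨ x = O (o (D.rot a)) ∨
        ∃ e, D.vertexOf e = D.vertexOf b ∧ e ≠ D.rot b ∧ x = O (o e)} : Set _) ∨
      y ∈ ({x | x = N 3 ∨ x = N 0 ∨ x = O (n 1) ∨ x = O (n 2) ∨ x = O (o (D.rot b)) ∨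
        ∃ e, D.vertexOf e = D.vertexOf a ∧ e ≠ D.rot a ∧ x = O (o e)} : Set _) := by
    have hy := h.left
    rcases join_cases _ _ _ y with ⟨y, rfl⟩ | ⟨i, rfl⟩
    · rcases join_cases _ _ _ y with ⟨d, rfl⟩ | ⟨i, rfl⟩
      · have hd := (htO d).1 hy
        rcases hall d with hda | hdb
        · exact Or.inr (Or.inr (Or.inr (Or.inr (Or.inr (Or.inr ⟨d, hda, hd.2.1, rfl⟩)))))
        · exact Or.inl (Or.inr (Or.inr (Or.inr (Or.inr (Or.inr ⟨d, hdb, hd.2.2, rfl⟩)))))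
      · rcases (htn i).1 hy with rfl | rfl
        · exact Or.inr (Or.inr (Or.inr (Or.inl rfl)))
        · exact Or.inl (Or.inr (Or.inr (Or.inl rfl)))
    · rcases (htN i).1 hy with rfl | rfl
      · exact Or.inl (Or.inl rfl)
      · exact Or.inr (Or.inl rfl)
  rcases hcases with hy | hy
  -- The tip `rot (rot b)` is still free: it differs from `b` by `hrot2` and from `rot b` by `hrot`.
  · refine h.forced_of_mem (c := O (n 3)) (w := N 1) (d := O (o (D.rot (D.rot b)))) ?_ ?_ ?_ ?_ ?_
      (hadjn _ _) (hadjN _ _) ?_ hy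
    · rintro _ (rfl | rfl | rfl | rfl | rfl | ⟨e, he, heb, rfl⟩)
      · exact Or.inr (Or.inl hN1)
      · exact Or.inr (Or.inr (Or.inr (Or.inr (Or.inr ⟨_, hrrb, hrot _, hN2⟩))))
      · exact Or.inr (Or.inr (Or.inr (Or.inl (by rw [hfO _ (hno _ _) (hno _ _), hn3]))))
      · exact Or.inr (Or.inr (Or.inr (Or.inr (Or.inl (by
          rw [hfO _ (hno _ _) (hno _ _), hn0])))))
      · exact Or.inl hOa
      · rw [hfO _ (by rw [Ne, hoi]; exact hab2 he) (by rwa [Ne, hoi])]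
        by_cases heb' : e = b
        · subst heb'
          exact Or.inr (Or.inr (Or.inl (congrArg O hob)))
        · refine Or.inr (Or.inr (Or.inr (Or.inr (Or.inr ⟨D.rot e, ?_, ?_, ?_⟩))))
          · rw [vertexOf_rot, he]
          · exact fun h => heb' (D.rot.injective h)
          · rw [hface _ (hab' he) heb']
    · exact Or.inr (Or.inr (Or.inl rfl))
    · exact (htO _).2 ⟨⟨hab' hrrb, hrot2 b⟩, hab2 hrrb, hrot _⟩
    · rw [← hN2, faceOf_facePerm, ← hN1, faceOf_facePerm]
    · rintro _ (rfl | rfl | rfl | rfl | rfl | ⟨e, he, heb, rfl⟩) ht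
      · exact Or.inr (Or.inl rfl)
      · simp [htN] at ht
      · exact Or.inl rfl
      · simp [htn] at ht
      · simp [htO] at ht
      · exact Or.inr (Or.inr ((hvO _ _).2 (he.trans hrrb.symm)))
    -- Three steps lead from `n 3` through `n 0` and `rot a` to `N 1`; both darts in between are
    -- ends of edges.
    · refine ⟨2, ?_, ?_⟩
      · simp only [Function.iterate_succ_apply, Function.iterate_zero_apply]
        rw [hfO _ (hno _ _) (hno _ _), hn3, hfO _ (hno _ _) (hno _ _), hn0, hOa]
      · intro i hi
        interval_cases i
        · rw [Function.iterate_one, hfO _ (hno _ _) (hno _ _), hn3, htn]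
          decide
        · simp only [Function.iterate_succ_apply, Function.iterate_zero_apply]
          rw [hfO _ (hno _ _) (hno _ _), hn3, hfO _ (hno _ _) (hno _ _), hn0, htO]
          simp
  · refine h.forced_of_mem (c := O (n 1)) (w := N 3) (d := O (o (D.rot (D.rot a)))) ?_ ?_ ?_ ?_ ?_
      (hadjn _ _) (hadjN _ _) ?_ hy
    · rintro _ (rfl | rfl | rfl | rfl | rfl | ⟨e, he, hea, rfl⟩)
      · exact Or.inr (Or.inl hN3)
      · exact Or.inr (Or.inr (Or.inr (Or.inr (Or.inr ⟨_, hrra, hrot _, hN0⟩))))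
      · exact Or.inr (Or.inr (Or.inr (Or.inl (by rw [hfO _ (hno _ _) (hno _ _), hn1]))))
      · exact Or.inr (Or.inr (Or.inr (Or.inr (Or.inl (by
          rw [hfO _ (hno _ _) (hno _ _), hn2])))))
      · exact Or.inl hOb
      · rw [hfO _ (by rwa [Ne, hoi]) (by rw [Ne, hoi]; exact hba2 he)]
        by_cases hea' : e = a
        · subst hea'
          exact Or.inr (Or.inr (Or.inl (congrArg O hoa)))
        · refine Or.inr (Or.inr (Or.inr (Or.inr (Or.inr ⟨D.rot e, ?_, ?_, ?_⟩))))
          · rw [vertexOf_rot, he]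
          · exact fun h => hea' (D.rot.injective h)
          · rw [hface _ hea' (hba' he)]
    · exact Or.inr (Or.inr (Or.inl rfl))
    · exact (htO _).2 ⟨⟨hrot2 a, hba' hrra⟩, hrot _, hba2 hrra⟩
    · rw [← hN0, faceOf_facePerm, ← hN3, faceOf_facePerm]
    · rintro _ (rfl | rfl | rfl | rfl | rfl | ⟨e, he, hea, rfl⟩) ht
      · exact Or.inr (Or.inl rfl)
      · simp [htN] at ht
      · exact Or.inl rfl
      · simp [htn] at ht
      · simp [htO] at ht
      · exact Or.inr (Or.inr ((hvO _ _).2 (he.trans hrra.symm)))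
    · refine ⟨2, ?_, ?_⟩
      · simp only [Function.iterate_succ_apply, Function.iterate_zero_apply]
        rw [hfO _ (hno _ _) (hno _ _), hn1, hfO _ (hno _ _) (hno _ _), hn2, hOb]
      · intro i hi
        interval_cases i
        · rw [Function.iterate_one, hfO _ (hno _ _) (hno _ _), hn1, htn]
          decide
        · simp only [Function.iterate_succ_apply, Function.iterate_zero_apply]
          rw [hfO _ (hno _ _) (hno _ _), hn1, hfO _ (hno _ _) (hno _ _), hn2, htO]
          simp

/-- At least three tips per spot, encoded in `hrot` and `hrot2`, leave a free tip at each spot after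
both moves. Without it the later answer in that face would be missing. -/
theorem exists_reply_opening (htip : ∀ d, D.IsTip d)
    (hvertex : ∀ d e f : D.Dart, D.vertexOf d ≠ D.vertexOf e →
      D.vertexOf f = D.vertexOf d ∨ D.vertexOf f = D.vertexOf e)
    (hrot : ∀ d, D.rot d ≠ d) (hrot2 : ∀ d, D.rot (D.rot d) ≠ d) {E : SproutDrawing}
    (hm : Move 4 D E) : ∃ R, Move 4 E R ∧ R.AllForced := by
  obtain ⟨a, b, hab, ha, hb, rfl, hE⟩ := hm
  have hv := vertexOf_ne_of_isSimple_join hab ha hb hE.2.1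
  have hall := fun d => hvertex a b d hv
  have hE' := isAdmissible_join_of_isTip hab ha hb hall hE
  have hj := joinable_rot_rot hab htip hv hrot
  exact ⟨_, hj.move hE', hE'.join _ _ _ hj, fun y z hyz =>
    forced_of_joinable_opening hab htip hv hall hrot hrot2 _ _ _ hyz⟩

end Opening

/-! ### The starting position with two spots -/

theorem finRotate_ne_self {n : ℕ} (hn : 3 ≤ n) (x : Fin n) :
    finRotate n x ≠ x ∧ finRotate n (finRotate n x) ≠ x := by
  obtain ⟨k, rfl⟩ := Nat.exists_eq_add_of_le' hn
  simp only [finRotate_apply, Ne, add_assoc, add_eq_left]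
  constructor <;>
  · rw [Fin.ext_iff, Fin.val_zero]
    simp [Fin.val_add, Nat.mod_eq_of_lt]

theorem twoSpots_vertexOf (p q : ℕ) (d e f : (twoSpots p q).Dart)
    (h : (twoSpots p q).vertexOf d ≠ (twoSpots p q).vertexOf e) :
    (twoSpots p q).vertexOf f = (twoSpots p q).vertexOf d ∨
      (twoSpots p q).vertexOf f = (twoSpots p q).vertexOf e := by
  have hl : ∀ x y, (twoSpots p q).vertexOf (Sum.inl x) = (twoSpots p q).vertexOf (Sum.inl y) :=
    fun x y => vertexOf_eq_iff.2
      (Equiv.Perm.sameCycle_sumCongr_inl.2 (sameCycle_finRotate x y))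
  have hr : ∀ x y, (twoSpots p q).vertexOf (Sum.inr x) = (twoSpots p q).vertexOf (Sum.inr y) :=
    fun x y => vertexOf_eq_iff.2
      (Equiv.Perm.sameCycle_sumCongr_inr.2 (sameCycle_finRotate x y))
  rcases d with d | d <;> rcases e with e | e <;> rcases f with f | f
  · exact Or.inl (hl _ _)
  · exact absurd (hl _ _) h
  · exact Or.inl (hl _ _)
  · exact Or.inr (hr _ _)
  · exact Or.inr (hl _ _)
  · exact Or.inl (hr _ _)
  · exact absurd (hr _ _) h
  · exact Or.inl (hr _ _)

theorem twoSpots_rot_ne {p q : ℕ} (hp : 3 ≤ p) (hq : 3 ≤ q) (d : (twoSpots p q).Dart) :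
    (twoSpots p q).rot d ≠ d ∧ (twoSpots p q).rot ((twoSpots p q).rot d) ≠ d := by
  rcases d with d | d
  · exact ⟨fun h => (finRotate_ne_self hp d).1 (Sum.inl_injective h),
      fun h => (finRotate_ne_self hp d).2 (Sum.inl_injective h)⟩
  · exact ⟨fun h => (finRotate_ne_self hq d).1 (Sum.inr_injective h),
      fun h => (finRotate_ne_self hq d).2 (Sum.inr_injective h)⟩

end SproutDrawing

theorem mainTheorem3 (p q : ℕ) (hp : 3 ≤ p) (hq : 3 ≤ q) :
    SecondPlayerHasWinningStrategy (SproutDrawing.Move 4) (SproutDrawing.twoSpots p q) := by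
  -- The invariant includes connectedness, which fails for two isolated spots, so the opening round
  -- is handled separately.
  refine .of_invariant SproutDrawing.AllForced (fun D => D.joinablePairs.ncard) ?_ ?_
  · exact fun Q => SproutDrawing.exists_reply_opening
      (D := SproutDrawing.twoSpots p q) (fun _ => rfl)
      (SproutDrawing.twoSpots_vertexOf p q) (fun d => (SproutDrawing.twoSpots_rot_ne hp hq d).1)
      (fun d => (SproutDrawing.twoSpots_rot_ne hp hq d).2)
  · exact fun D Q hD hm => hD.exists_reply hm
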